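/- Let $O$ be the origin of $\mathbb R^3$, and let $G$ be a rational ruled surface $g(u,v)=c(u)+v\,e(u)$ with $c,e\in\mathbb R(u)^3$, such that $g,g_u,g_v$ are linearly independent at some parameter $(u,v)$ (that is, $G$ is a surface, and it is neither a cone with vertex $O$ nor a plane through $O$). Call $(u,v)$ regular if it is not a pole of $c$ or $e$ and $g,g_u,g_v$ are linearly independent there. For $P\ne O$ let $\alpha^\star(P)$ be the plane $x\cdot P=P\cdot P$ through $P$ with normal $OP$. The inverse pedal surface $F=\alpha^\star(G)$ is the envelope of the planes $\alpha^\star(g(u,v))$, that is, the set of the solutions $x$ of $x\cdot g=g\cdot g$, $x\cdot g_u=(g\cdot g)_u$, $x\cdot g_v=(g\cdot g)_v$ at regular parameters. A polar representation of $G$ over an open set $U\subset\mathbb R^2$ consists of smooth functions $v(u,t)$, $r(u,t)\neq0$, $s(u,t)$ with $\|s\|=1$, $v_t\ne0$, $(u,v(u,t))$ regular, and $g(u,v(u,t))=r(u,t)\,s(u,t)$; the corresponding conchoid $G_d$ is $(r+d)\,s$. Then the following hold. 1. There is a polar representation of $G$, defined on the complement $D$ of the zero set of a nonzero polynomial in $(u,t)$,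 with $v$, $r$ and $s=n$ rational, and a rational map $f(u,t)$, defined and immersed on $D$, such that $f(u,t)$ is the point of $F$ at the parameter $(u,v(u,t))$ and $n(u,t)$ is a unit normal of $f$ at $(u,t)$. The image $f(D)$ is contained in $F$ and dense in $F$, and the points $r\,n$ are dense in the set of the points of $G$ at regular parameters. Hence $F$ has a rational parametrization with rational unit normal. 2. For each $u$ that is not a pole and for which $c(u),e(u)$ are linearly independent, let $\mathbf d(u)$ be the foot-point of $O$ on the line $l(u)=c(u)+\mathbb R e(u)$, let $p(u)$ be the parabola with focus $O$ and vertex $\mathbf d(u)$ in the plane $\Pi(u)$ of $O$ and $l(u)$ (its directrix is the parallel of $l(u)$ through $2\mathbf d(u)$), and let $P(u)$ be the cylinder over $p(u)$ with generators orthogonal to $\Pi(u)$. Measuring $v$ from the foot-point, $p(u)$ is parametrized by $\left(1-\frac{v^2 e^2}{\mathbf d^2}\right)\mathbf d+2v\,e$, and $P(u)$ by adding the multiples of $\mathbf d\times e$. The parabolic cylinders $P(u)$ form a rational family: there is a polynomial $H(u,x)$ such that $P(u)=\{x: H(u,x)=0\}$ for all these $u$. 3. For every polar representation $(v,r,s)$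 of $G$ over $U$, the point $f(u,t)$ of the envelope $F$ at $(u,v(u,t))$ exists, is unique and depends smoothly on $(u,t)\in U$, and $s$ is a unit normal field of $f$. For every $d\in\mathbb R$, let $F_d$ be the offset $f_d=f+d\,s$. Then $s$ is a unit normal field of $f_d$, and $\alpha^\star$ maps $G_d$ to $F_d$: wherever $r+d\neq0$, the plane $\alpha^\star((r+d)s)$ passes through $f_d(u,t)$ (and has normal $s$), and $f_d(u,t)$ is the unique point of the envelope of these planes at $(u,t)$. 4. In the situation of 3, $s(u,t)$ lies in $\Pi(u)$ and is a unit normal of $p(u)$ and of $P(u)$ at the points with parameter $v(u,t)$. For every $d\in\mathbb R$, let $P_d(u)$ be the offset cylinder, obtained by adding $d\,s$ to the points of $P(u)$. Its cross section with $\Pi(u)$ is the offset at distance $d$ of the parabola $p(u)$. $F_d$ is the envelope of the cylinders $P_d(u)$ (in particular, for $d=0$, $F$ is the envelope of the $P(u)$): the parametrization of $P_d(u)$ is regular along the generators of a dense set of parameters $(u,t)\in U$; every generator contains the point $f_d(u,t)$; on a generator along which $P_d(u)$ is regular this is the only point at which the three partial derivatives of the parametrized family of cylinders are linearly dependent; and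 there the tangent vectors of $f_d$ are tangent to $P_d(u)$. -/

import Mathlib

open scoped ContDiff

noncomputable section

namespace PedalGeom

/-- Euclidean 3-space; the reference point `O` is the origin. -/
abbrev E3 := EuclideanSpace ℝ (Fin 3)

/-- First partial derivative of a map of two real parameters. -/
def dFst {V : Type*} [NormedAddCommGroup V] [NormedSpace ℝ V] (f : ℝ → ℝ → V) (u t : ℝ) : V :=
  deriv (fun u' => f u' t) u

/-- Second partial derivative of a map of two real parameters. -/
def dSnd {V : Type*} [NormedAddCommGroup V] [NormedSpace ℝ V] (f : ℝ → ℝ → V) (u t : ℝ) : V :=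
  deriv (fun t' => f u t') t

/-- Cross product on `E3`. -/
def cross (a b : E3) : E3 := WithLp.toLp 2 (crossProduct (WithLp.ofLp a) (WithLp.ofLp b))

/-! ### Rational curves, rational functions of two variables -/

/-- A rational curve (or rational vector field along the line): three rational functions. -/
abbrev RatCurve := Fin 3 → RatFunc ℝ

/-- The point of a rational curve at the parameter `u` (meaningful where no denominator
vanishes, see `RatCurve.RegularAt`). -/
def RatCurve.at (c : RatCurve) (u : ℝ) : E3 :=
  WithLp.toLp 2 (fun i => (c i).eval (RingHom.id ℝ) u)

/-- `u` is not a pole of the rational curve. -/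
def RatCurve.RegularAt (c : RatCurve) (u : ℝ) : Prop :=
  ∀ i, (c i).denom.eval u ≠ 0

/-- The Zariski-open subset of the parameter plane where the polynomial does not vanish. -/
def nonvanishing (Δ : MvPolynomial (Fin 2) ℝ) : Set (ℝ × ℝ) :=
  {p | MvPolynomial.eval ![p.1, p.2] Δ ≠ 0}

/-- `h` is given on `D` by a quotient of two polynomials without poles in `D`. -/
def IsRationalOn (h : ℝ → ℝ → ℝ) (D : Set (ℝ × ℝ)) : Prop :=
  ∃ P Q : MvPolynomial (Fin 2) ℝ, ∀ u t, (u, t) ∈ D →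
    MvPolynomial.eval ![u, t] Q ≠ 0 ∧
      h u t = MvPolynomial.eval ![u, t] P / MvPolynomial.eval ![u, t] Q

/-- All three coordinates are rational on `D`. -/
def IsRationalMapOn (f : ℝ → ℝ → E3) (D : Set (ℝ × ℝ)) : Prop :=
  ∀ i, IsRationalOn (fun u t => f u t i) D

/-! ### Inverse foot-point map, inverse pedal surface, conchoids and offsets -/

/-- The inverse foot-point map: the plane through `P` with normal `OP` (for `P ≠ O`). -/
def alphaStar (P : E3) : Set E3 := {x | inner ℝ x P = inner ℝ P P}

/-- `x` is a point of the envelope of the two-parameter family of planes `α*(g(u,t))` at the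
parameter `(u,t)`: it lies on the plane and on the two derived planes. -/
def IsInvPedalPoint (g : ℝ → ℝ → E3) (u t : ℝ) (x : E3) : Prop :=
  x ∈ alphaStar (g u t) ∧
    dFst (fun u' t' => inner ℝ x (g u' t') - inner ℝ (g u' t') (g u' t')) u t = 0 ∧
    dSnd (fun u' t' => inner ℝ x (g u' t') - inner ℝ (g u' t') (g u' t')) u t = 0

/-- The parametrization `c(u) + v e(u)` of a ruled surface. -/
def ruled (c e : RatCurve) (u v : ℝ) : E3 := c.at u + v • e.at u

/-- `(u,v)` is a parameter at which the ruled surface is regular and its tangent plane does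
not pass through `O`. -/
def RegularParam (c e : RatCurve) (u v : ℝ) : Prop :=
  c.RegularAt u ∧ e.RegularAt u ∧
    LinearIndependent ℝ
      ![ruled c e u v, dFst (ruled c e) u v, dSnd (ruled c e) u v]

/-- The inverse pedal surface `F = α*(G)` of the ruled surface `G`, as a set of points. -/
def invPedalSurface (c e : RatCurve) : Set E3 :=
  {x | ∃ u v, RegularParam c e u v ∧ IsInvPedalPoint (ruled c e) u v x}

/-- A polar representation `r s`, with `‖s‖ = 1`, of the ruled surface over the open set `U`;
the second parameter `v` of the ruled surface is replaced by `v(u,t)`. -/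
structure IsPolarRep (c e : RatCurve) (U : Set (ℝ × ℝ)) (v r : ℝ → ℝ → ℝ) (s : ℝ → ℝ → E3) :
    Prop where
  isOpen : IsOpen U
  smooth_v : ContDiffOn ℝ ∞ (fun p : ℝ × ℝ => v p.1 p.2) U
  smooth_r : ContDiffOn ℝ ∞ (fun p : ℝ × ℝ => r p.1 p.2) U
  smooth_s : ContDiffOn ℝ ∞ (fun p : ℝ × ℝ => s p.1 p.2) U
  regular : ∀ u t, (u, t) ∈ U → RegularParam c e u (v u t)
  reparam : ∀ u t, (u, t) ∈ U → dSnd v u t ≠ 0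
  unit : ∀ u t, (u, t) ∈ U → ‖s u t‖ = 1
  radius_ne : ∀ u t, (u, t) ∈ U → r u t ≠ 0
  polar : ∀ u t, (u, t) ∈ U → ruled c e u (v u t) = r u t • s u t

/-- The conchoid of `r s` at distance `d`. -/
def conchoid (r : ℝ → ℝ → ℝ) (s : ℝ → ℝ → E3) (d : ℝ) (u t : ℝ) : E3 := (r u t + d) • s u t

/-- The one-sided offset of `f` at distance `d` with respect to the unit normal field `n`. -/
def offset (f n : ℝ → ℝ → E3) (d : ℝ) (u t : ℝ) : E3 := f u t + d • n u t

/-- `n` is a unit normal vector field of `f` over `U`. -/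
def IsUnitNormalOn (f n : ℝ → ℝ → E3) (U : Set (ℝ × ℝ)) : Prop :=
  ∀ u t, (u, t) ∈ U →
    ‖n u t‖ = 1 ∧ inner ℝ (n u t) (dFst f u t) = 0 ∧ inner ℝ (n u t) (dSnd f u t) = 0

/-! ### Parabolic cylinders -/

/-- The foot-point of `O` on the ruling at `u`. -/
def foot (c e : RatCurve) (u : ℝ) : E3 :=
  c.at u - (inner ℝ (c.at u) (e.at u) / inner ℝ (e.at u) (e.at u)) • e.at u

/-- The plane through `O` that contains the ruling at `u`. -/
def sectionPlane (c e : RatCurve) (u : ℝ) : Submodule ℝ E3 :=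
  Submodule.span ℝ {c.at u, e.at u}

/-- The parabola in the plane of `O` and the ruling at `u` with focus `O`, whose vertex is the
foot-point of `O` on the ruling: its directrix is the parallel of the ruling through
twice the foot-point. -/
def parabola (c e : RatCurve) (u : ℝ) : Set E3 :=
  {y | y ∈ sectionPlane c e u ∧
    dist y 0 = Metric.infDist y {z | ∃ k : ℝ, z = (2 : ℝ) • foot c e u + k • e.at u}}

/-- The right cylinder over the parabola. -/
def parabolicCylinder (c e : RatCurve) (u : ℝ) : Set E3 :=
  {x | ∃ y ∈ parabola c e u, x - y ∈ (sectionPlane c e u)ᗮ}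

/-- The parametrization of the parabola by the points of the ruling; `k` is the parameter of
the point `c(u) + v e(u)` measured from the foot-point. -/
def parabolaPoint (c e : RatCurve) (u v : ℝ) : E3 :=
  let k := v + inner ℝ (c.at u) (e.at u) / inner ℝ (e.at u) (e.at u)
  (1 - k ^ 2 * inner ℝ (e.at u) (e.at u) / inner ℝ (foot c e u) (foot c e u)) • foot c e u
    + (2 * k) • e.at u

/-- Direction of the generators of the cylinder. -/
def axisDir (c e : RatCurve) (u : ℝ) : E3 := cross (foot c e u) (e.at u)

/-- The offset cylinder at distance `d`, for the reparametrization `v(u,t)` and the unit normal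
`s(u,t)`; for `d = 0` this is the parabolic cylinder itself. -/
def offsetCylinder (c e : RatCurve) (v : ℝ → ℝ → ℝ) (s : ℝ → ℝ → E3) (d : ℝ) (u t l : ℝ) : E3 :=
  parabolaPoint c e u (v u t) + l • axisDir c e u + d • s u t

/-! ### Envelopes of one-parameter families of parametrized surfaces -/

/-- `(t,l) ↦ q u t l` is immersed at `(t,l)`. -/
def MemberRegular (q : ℝ → ℝ → ℝ → E3) (u t l : ℝ) : Prop :=
  LinearIndependent ℝ ![deriv (fun t' => q u t' l) t, deriv (fun l' => q u t l') l]

/-- Characteristic condition: the velocity of the family is tangent to the member. -/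
def Characteristic (q : ℝ → ℝ → ℝ → E3) (u t l : ℝ) : Prop :=
  ¬ LinearIndependent ℝ
    ![deriv (fun u' => q u' t l) u, deriv (fun t' => q u t' l) t, deriv (fun l' => q u t l') l]

/-- The surface `f` is the envelope of the family of surfaces `q u`: the members are regular at
generic parameters; the curve `f u ·` lies on the member `q u`; at regular points
of the member it consists exactly of the characteristic points; and
there the tangent vectors of `f` are tangent to the member. -/
structure IsEnvelopeOn (q : ℝ → ℝ → ℝ → E3) (f : ℝ → ℝ → E3) (U : Set (ℝ × ℝ)) : Prop where
  generic : U ⊆ closure {p | p ∈ U ∧ ∀ l, MemberRegular q p.1 p.2 l}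
  mem : ∀ u t, (u, t) ∈ U → ∃ l, q u t l = f u t
  characteristic : ∀ u t, (u, t) ∈ U → ∀ l, MemberRegular q u t l →
    (Characteristic q u t l ↔ q u t l = f u t)
  tangent : ∀ u t, (u, t) ∈ U → ∀ l, MemberRegular q u t l → q u t l = f u t →
    dFst f u t ∈ Submodule.span ℝ
        {deriv (fun t' => q u t' l) t, deriv (fun l' => q u t l') l} ∧
      dSnd f u t ∈ Submodule.span ℝ
        {deriv (fun t' => q u t' l) t, deriv (fun l' => q u t l') l}

end PedalGeom

end

open PedalGeom

namespace PedalGeom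

/-! Write the ruled surface as g = r s with |s| = 1. The plane `alphaStar g` is x·s = r, so r is the
support function of the envelope for the normal s, and the envelope point f is the solution of x·s =
r, x·s_u = r_u, x·s_t = r_t. The conchoid replaces r by r + d and leaves the last two equations
unchanged. As s is orthogonal to s_u and s_t, the new solution is f + d s: conchoids correspond to
offsets (`isInvPedalPoint_conchoid_iff`, `eq_offset_iff`).

The equations x·s = r + d and x·s_t = r_t involve only the ruling at u. For d = 0 their solution in
the plane of O and the ruling is a point of the parabola, which is the inverse pedal curve of the
ruling with respect to its focus; in space their solutions form a generator of the offset cylinder.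
The remaining equation x·s_u = r_u is the characteristic condition of the family of cylinders and
selects f + d s on the generator (`characteristic_iff`).

For rationality one needs a vector of rational length in the plane of O and the ruling. A
nonnegative polynomial is a sum of two squares, so the normal of this plane has the length of some
vector (p, q, 0), and a reflection exchanging the two carries the third basis vector into the plane
(`exists_rational_length`). Rotating it by a half-angle parameter and intersecting with the ruling
gives a rational polar representation (`exists_rational_polar`); f is then rational because it
solves a rational linear system.

The delicate point is that f is immersed somewhere (`exists_immersed`). Otherwise the second
fundamental form degenerates along every generic ruling, which is a polynomial identity in v.
Divisibility by the irreducible quadratic |g|² forces det(c, e', e) = 0 and a second order relation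
(`ruling_relation`); the derivative of the first contradicts the second (`deriv_relation_false`).
The points where f is not immersed therefore lie in the zero set of a nonzero polynomial, which can
be removed without losing density. -/

/-! ### Vector algebra in Euclidean 3-space -/

theorem inner_eq (x y : E3) : inner ℝ x y = x 0 * y 0 + x 1 * y 1 + x 2 * y 2 := by
  simp [PiLp.inner_apply, Fin.sum_univ_three, mul_comm]

@[simp] theorem cross_zero (a b : E3) : cross a b 0 = a 1 * b 2 - a 2 * b 1 := by
  simp [cross, cross_apply]

@[simp] theorem cross_one (a b : E3) : cross a b 1 = a 2 * b 0 - a 0 * b 2 := by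
  simp [cross, cross_apply]

@[simp] theorem cross_two (a b : E3) : cross a b 2 = a 0 * b 1 - a 1 * b 0 := by
  simp [cross, cross_apply]

theorem ext3 {x y : E3} (h0 : x 0 = y 0) (h1 : x 1 = y 1) (h2 : x 2 = y 2) : x = y := by
  ext i
  fin_cases i <;> assumption

theorem eq_zero_of_inner_self {x : E3} (h : inner ℝ x x = 0) : x = 0 := inner_self_eq_zero.1 h

/-- The Lagrange identity. -/
theorem inner_cross_self (a b : E3) :
    inner ℝ (cross a b) (cross a b) = inner ℝ a a * inner ℝ b b - inner ℝ a b ^ 2 := by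
  simp only [inner_eq, cross_zero, cross_one, cross_two]; ring

theorem inner_cross_cross (a b x y : E3) : inner ℝ (cross a b) (cross x y) =
    inner ℝ a x * inner ℝ b y - inner ℝ a y * inner ℝ b x := by
  simp only [inner_eq, cross_zero, cross_one, cross_two]; ring

theorem inner_left_cross (a b : E3) : inner ℝ a (cross a b) = 0 := by
  simp only [inner_eq, cross_zero, cross_one, cross_two]; ring

theorem inner_right_cross (a b : E3) : inner ℝ b (cross a b) = 0 := by
  simp only [inner_eq, cross_zero, cross_one, cross_two]; ring

theorem linearIndependent_pair_iff (a b : E3) :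
    LinearIndependent ℝ ![a, b] ↔ cross a b ≠ 0 := by
  have h : LinearIndependent ℝ ![a, b] ↔ LinearIndependent ℝ ![a.ofLp, b.ofLp] := by
    rw [← LinearMap.linearIndependent_iff (WithLp.linearEquiv 2 ℝ (Fin 3 → ℝ)).toLinearMap
      (LinearEquiv.ker _)]
    congr! 1
    ext i
    fin_cases i <;> rfl
  rw [h, ← crossProduct_ne_zero_iff_linearIndependent, cross]
  simp

theorem linearIndependent_triple_iff (a b c : E3) :
    LinearIndependent ℝ ![a, b, c] ↔ inner ℝ a (cross b c) ≠ 0 := by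
  have h : LinearIndependent ℝ ![a, b, c] ↔
      LinearIndependent ℝ (Matrix.of ![a.ofLp, b.ofLp, c.ofLp]).row := by
    rw [← LinearMap.linearIndependent_iff (WithLp.linearEquiv 2 ℝ (Fin 3 → ℝ)).toLinearMap
      (LinearEquiv.ker _)]
    congr! 1
    ext i
    fin_cases i <;> rfl
  rw [h, Matrix.linearIndependent_rows_iff_isUnit, Matrix.isUnit_iff_isUnit_det, isUnit_iff_ne_zero]
  have : (Matrix.of ![a.ofLp, b.ofLp, c.ofLp]).det = inner ℝ a (cross b c) := by
    rw [Matrix.det_fin_three, inner_eq, cross_zero, cross_one, cross_two]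
    simp; ring
  rw [this]

/-- Expansion of a vector in the basis dual to `a, b, c`. -/
theorem triple_smul_eq (a b c x : E3) : inner ℝ a (cross b c) • x =
    inner ℝ x a • cross b c + inner ℝ x b • cross c a + inner ℝ x c • cross a b := by
  apply ext3 <;>
  simp only [inner_eq, cross_zero, cross_one, cross_two, PiLp.smul_apply, PiLp.add_apply,
    smul_eq_mul] <;> ring

theorem eq_of_inner_eq {a b c x y : E3} (h : inner ℝ a (cross b c) ≠ 0)
    (ha : inner ℝ x a = inner ℝ y a) (hb : inner ℝ x b = inner ℝ y b)
    (hc : inner ℝ x c = inner ℝ y c) : x = y := by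
  have := triple_smul_eq a b c x
  rw [ha, hb, hc, ← triple_smul_eq] at this
  exact smul_right_injective _ h this

theorem eq_smul_cross {a b y : E3} (h : cross a b ≠ 0) (ha : inner ℝ y a = 0)
    (hb : inner ℝ y b = 0) : ∃ l : ℝ, y = l • cross a b := by
  have hn : inner ℝ (cross a b) (cross a b) ≠ 0 := fun h' => h (eq_zero_of_inner_self h')
  refine ⟨inner ℝ y (cross a b) / inner ℝ (cross a b) (cross a b), ?_⟩
  have := triple_smul_eq (cross a b) a b y
  rw [ha, hb, zero_smul, zero_smul, add_zero, add_zero] at this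
  rw [div_eq_inv_mul, mul_smul, ← this, smul_smul, inv_mul_cancel₀ hn, one_smul]

/-- The span of `a` and `b` is the whole plane orthogonal to `s`; tangency to a cylinder thus
becomes orthogonality to its normal. -/
theorem mem_span_pair_of_inner {a b s x : E3} (h : LinearIndependent ℝ ![a, b]) (hs : s ≠ 0)
    (ha : inner ℝ s a = 0) (hb : inner ℝ s b = 0) (hx : inner ℝ s x = 0) :
    x ∈ Submodule.span ℝ {a, b} := by
  rw [linearIndependent_pair_iff] at h
  obtain ⟨l, hl⟩ := eq_smul_cross h ha hb
  have hl0 : l ≠ 0 := by rintro rfl; exact hs (by simpa using hl)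
  have hx' : inner ℝ (cross a b) x = 0 := by
    rw [hl, real_inner_smul_left] at hx
    exact (mul_eq_zero.1 hx).resolve_left hl0
  have hn : inner ℝ (cross a b) (cross a b) ≠ 0 := fun h' => h (eq_zero_of_inner_self h')
  rw [Submodule.mem_span_pair]
  refine ⟨inner ℝ x (cross b (cross a b)) / inner ℝ (cross a b) (cross a b),
    inner ℝ x (cross (cross a b) a) / inner ℝ (cross a b) (cross a b), ?_⟩
  have key : inner ℝ (cross a b) (cross a b) • x =
      inner ℝ x (cross b (cross a b)) • a + inner ℝ x (cross (cross a b) a) • b +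
        inner ℝ (cross a b) x • cross a b := by
    apply ext3 <;>
    simp only [inner_eq, cross_zero, cross_one, cross_two, PiLp.smul_apply, PiLp.add_apply,
      smul_eq_mul] <;> ring
  rw [hx', zero_smul, add_zero] at key
  rw [div_eq_inv_mul, div_eq_inv_mul, mul_smul, mul_smul, ← smul_add, ← key, smul_smul,
    inv_mul_cancel₀ hn, one_smul]

/-- The normal `s` is a nonzero multiple of `cross a b`. This turns the characteristic condition of
an envelope into one scalar equation. -/
theorem linearIndependent_triple_iff_inner_normal {a b s x : E3}
    (h : LinearIndependent ℝ ![a, b]) (hs : s ≠ 0)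
    (ha : inner ℝ s a = 0) (hb : inner ℝ s b = 0) :
    LinearIndependent ℝ ![x, a, b] ↔ inner ℝ s x ≠ 0 := by
  rw [linearIndependent_pair_iff] at h
  obtain ⟨l, hl⟩ := eq_smul_cross h ha hb
  have hl0 : l ≠ 0 := by rintro rfl; exact hs (by simpa using hl)
  rw [linearIndependent_triple_iff, hl, real_inner_smul_left, real_inner_comm]
  simp [hl0]

theorem contDiffAt_cross {E : Type*} [NormedAddCommGroup E] [NormedSpace ℝ E] {n : WithTop ℕ∞}
    {f g : E → E3} {x : E} (hf : ContDiffAt ℝ n f x) (hg : ContDiffAt ℝ n g x) :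
    ContDiffAt ℝ n (fun y => cross (f y) (g y)) x := by
  rw [contDiffAt_euclidean] at hf hg ⊢
  intro i
  fin_cases i
  · simpa using ((hf 1).mul (hg 2)).sub ((hf 2).mul (hg 1))
  · simpa using ((hf 2).mul (hg 0)).sub ((hf 0).mul (hg 2))
  · simpa using ((hf 0).mul (hg 1)).sub ((hf 1).mul (hg 0))

/-! ### Partial derivatives -/

section Partial

variable {V : Type*} [NormedAddCommGroup V] [NormedSpace ℝ V] {f g : ℝ → ℝ → V} {u t : ℝ}
  {U : Set (ℝ × ℝ)}

theorem hasDerivAt_dFst (h : DifferentiableAt ℝ (fun p : ℝ × ℝ => f p.1 p.2) (u, t)) :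
    HasDerivAt (fun u' => f u' t) (dFst f u t) u := by
  have : DifferentiableAt ℝ (fun u' : ℝ => (u', t)) u := by fun_prop
  exact (DifferentiableAt.comp u (g := fun p : ℝ × ℝ => f p.1 p.2) h this).hasDerivAt

theorem hasDerivAt_dSnd (h : DifferentiableAt ℝ (fun p : ℝ × ℝ => f p.1 p.2) (u, t)) :
    HasDerivAt (fun t' => f u t') (dSnd f u t) t := by
  have : DifferentiableAt ℝ (fun t' : ℝ => (u, t')) t := by fun_prop
  exact (DifferentiableAt.comp t (g := fun p : ℝ × ℝ => f p.1 p.2) h this).hasDerivAt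

theorem eventually_fst (hU : IsOpen U) (h : (u, t) ∈ U) : ∀ᶠ u' in nhds u, (u', t) ∈ U := by
  have : ContinuousAt (fun u' : ℝ => (u', t)) u := by fun_prop
  exact this.eventually (hU.mem_nhds h)

theorem eventually_snd (hU : IsOpen U) (h : (u, t) ∈ U) : ∀ᶠ t' in nhds t, (u, t') ∈ U := by
  have : ContinuousAt (fun t' : ℝ => (u, t')) t := by fun_prop
  exact this.eventually (hU.mem_nhds h)

theorem dFst_congr (hU : IsOpen U) (h : (u, t) ∈ U) (hfg : ∀ u t, (u, t) ∈ U → f u t = g u t) :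
    dFst f u t = dFst g u t :=
  Filter.EventuallyEq.deriv_eq ((eventually_fst hU h).mono fun _ hu => hfg _ _ hu)

theorem dSnd_congr (hU : IsOpen U) (h : (u, t) ∈ U) (hfg : ∀ u t, (u, t) ∈ U → f u t = g u t) :
    dSnd f u t = dSnd g u t :=
  Filter.EventuallyEq.deriv_eq ((eventually_snd hU h).mono fun _ hu => hfg _ _ hu)

/-- Functions that agree near a point have the same derivative there. -/
theorem hasDerivAt_unique_of_eventuallyEq {a b : ℝ → V} {a' b' : V} {x : ℝ}
    (ha : HasDerivAt a a' x) (hb : HasDerivAt b b' x) (h : ∀ᶠ y in nhds x, a y = b y) : a' = b' :=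
  (ha.congr_of_eventuallyEq (h.mono fun _ hy => hy.symm)).unique hb

end Partial

/-! ### Rational curves -/

theorem RatCurve.at_apply (c : RatCurve) (u : ℝ) (i : Fin 3) :
    c.at u i = (c i).num.eval u / (c i).denom.eval u := rfl

theorem RatCurve.contDiffAt {c : RatCurve} {u : ℝ} (h : c.RegularAt u) :
    ContDiffAt ℝ ∞ c.at u := by
  rw [contDiffAt_euclidean]
  intro i
  have hp (p : Polynomial ℝ) : ContDiffAt ℝ ∞ (fun x => p.eval x) u := by
    simpa using (Polynomial.contDiff_aeval (𝕜 := ℝ) p ∞).contDiffAt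
  exact (hp _).div (hp _) (h i)

theorem RatCurve.eventually_regularAt {c : RatCurve} {u : ℝ} (h : c.RegularAt u) :
    ∀ᶠ u' in nhds u, c.RegularAt u' := by
  simp only [RatCurve.RegularAt]
  rw [Filter.eventually_all]
  exact fun i => ((c i).denom.continuous.continuousAt).eventually_ne (h i)

theorem RatCurve.hasDerivAt {c : RatCurve} {u : ℝ} (h : c.RegularAt u) :
    HasDerivAt c.at (deriv c.at u) u :=
  ((RatCurve.contDiffAt h).differentiableAt (by simp)).hasDerivAt

theorem RatCurve.contDiffAt_deriv {c : RatCurve} {u : ℝ} (h : c.RegularAt u) :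
    ContDiffAt ℝ ∞ (deriv c.at) u := by
  exact (RatCurve.contDiffAt h).derivWithin (by simp)

/-! ### The envelope point of a ruled surface -/

/-- The derivative of the ruled surface `c + v e` with respect to `u`. -/
noncomputable def ruledVel (c e : RatCurve) (u v : ℝ) : E3 := deriv c.at u + v • deriv e.at u

/-- The determinant of `g, g_u, g_v` for the ruled surface `g = c + v e`. -/
noncomputable def ruledDet (c e : RatCurve) (u v : ℝ) : ℝ :=
  inner ℝ (ruled c e u v) (cross (ruledVel c e u v) (e.at u))

/-- The point of the inverse pedal surface at the parameter `(u, v)`. -/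
noncomputable def pedalPt (c e : RatCurve) (u v : ℝ) : E3 :=
  (2 : ℝ) • ruled c e u v -
    (inner ℝ (ruled c e u v) (ruled c e u v) / ruledDet c e u v) •
      cross (ruledVel c e u v) (e.at u)

variable {c e : RatCurve} {u v : ℝ}

theorem hasDerivAt_ruled_fst (hc : c.RegularAt u) (he : e.RegularAt u) :
    HasDerivAt (fun u' => ruled c e u' v) (ruledVel c e u v) u :=
  (RatCurve.hasDerivAt hc).add ((RatCurve.hasDerivAt he).const_smul v)

theorem hasDerivAt_ruled_snd : HasDerivAt (fun v' => ruled c e u v') (e.at u) v := by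
  have := ((hasDerivAt_id v).smul_const (e.at u)).const_add (c.at u)
  rwa [one_smul] at this

theorem regularParam_iff :
    RegularParam c e u v ↔ c.RegularAt u ∧ e.RegularAt u ∧ ruledDet c e u v ≠ 0 := by
  unfold RegularParam
  refine and_congr_right fun hc => and_congr_right fun he => ?_
  rw [linearIndependent_triple_iff, dFst, (hasDerivAt_ruled_fst hc he).deriv, dSnd,
    hasDerivAt_ruled_snd.deriv, ruledDet]

theorem inner_pedalPt_ruled (h : ruledDet c e u v ≠ 0) :
    inner ℝ (pedalPt c e u v) (ruled c e u v) = inner ℝ (ruled c e u v) (ruled c e u v) := by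
  rw [pedalPt, inner_sub_left, real_inner_smul_left, real_inner_smul_left,
    real_inner_comm (ruled c e u v) (cross _ _), ← ruledDet, div_mul_cancel₀ _ h]
  ring

theorem inner_pedalPt_ruledVel : inner ℝ (pedalPt c e u v) (ruledVel c e u v) =
    2 * inner ℝ (ruled c e u v) (ruledVel c e u v) := by
  rw [pedalPt, inner_sub_left, real_inner_smul_left, real_inner_smul_left,
    real_inner_comm (ruledVel c e u v) (cross _ _), inner_left_cross]
  ring

theorem inner_pedalPt_dir : inner ℝ (pedalPt c e u v) (e.at u) =
    2 * inner ℝ (ruled c e u v) (e.at u) := by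
  rw [pedalPt, inner_sub_left, real_inner_smul_left, real_inner_smul_left,
    real_inner_comm (e.at u) (cross _ _), inner_right_cross]
  ring

/-- The system has determinant `ruledDet`, hence at most one solution. The vector 2g already
satisfies the last two equations, and the correction in `pedalPt` is orthogonal to g_u and e, so it
repairs only the first. -/
theorem eq_pedalPt_iff (h : ruledDet c e u v ≠ 0) (x : E3) :
    x = pedalPt c e u v ↔
      inner ℝ x (ruled c e u v) = inner ℝ (ruled c e u v) (ruled c e u v) ∧
      inner ℝ x (ruledVel c e u v) = 2 * inner ℝ (ruled c e u v) (ruledVel c e u v) ∧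
      inner ℝ x (e.at u) = 2 * inner ℝ (ruled c e u v) (e.at u) := by
  constructor
  · rintro rfl
    exact ⟨inner_pedalPt_ruled h, inner_pedalPt_ruledVel, inner_pedalPt_dir⟩
  · rintro ⟨h1, h2, h3⟩
    apply eq_of_inner_eq h
    · rw [h1, inner_pedalPt_ruled h]
    · rw [h2, inner_pedalPt_ruledVel]
    · rw [h3, inner_pedalPt_dir]

theorem cross_ne_zero_of_ruledDet_ne (h : ruledDet c e u v ≠ 0) : cross (c.at u) (e.at u) ≠ 0 := by
  intro h0
  apply h
  have h0' : ∀ i, cross (c.at u) (e.at u) i = 0 := by simp [h0]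
  have e0 := h0' 0
  have e1 := h0' 1
  have e2 := h0' 2
  simp only [cross_zero, cross_one, cross_two] at e0 e1 e2
  simp only [ruledDet, ruled, ruledVel, inner_eq, cross_zero, cross_one, cross_two,
    PiLp.add_apply, PiLp.smul_apply, smul_eq_mul]
  -- The term v e drops out of the first factor, so the determinant is -g_u·(c × e).
  linear_combination
    (-(deriv c.at u 0 + v * deriv e.at u 0)) * e0 - (deriv c.at u 1 + v * deriv e.at u 1) * e1
      - (deriv c.at u 2 + v * deriv e.at u 2) * e2

theorem isInvPedalPoint_iff_of_hasDerivAt {g : ℝ → ℝ → E3} {u t : ℝ} {gu gt : E3}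
    (hu : HasDerivAt (fun u' => g u' t) gu u) (ht : HasDerivAt (fun t' => g u t') gt t) (x : E3) :
    IsInvPedalPoint g u t x ↔ inner ℝ x (g u t) = inner ℝ (g u t) (g u t) ∧
      inner ℝ x gu = 2 * inner ℝ (g u t) gu ∧ inner ℝ x gt = 2 * inner ℝ (g u t) gt := by
  have h1 := (((hasDerivAt_const u x).inner ℝ hu).sub (hu.inner ℝ hu)).deriv
  have h2 := (((hasDerivAt_const t x).inner ℝ ht).sub (ht.inner ℝ ht)).deriv
  unfold IsInvPedalPoint dFst dSnd
  refine and_congr Iff.rfl (and_congr ?_ ?_)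
  · refine (Iff.of_eq (congrArg (· = 0) h1)).trans ?_
    rw [real_inner_comm (g u t) gu, inner_zero_left]
    constructor <;> intro h <;> linarith
  · refine (Iff.of_eq (congrArg (· = 0) h2)).trans ?_
    rw [real_inner_comm (g u t) gt, inner_zero_left]
    constructor <;> intro h <;> linarith

theorem isInvPedalPoint_ruled_iff (h : RegularParam c e u v) (x : E3) :
    IsInvPedalPoint (ruled c e) u v x ↔ x = pedalPt c e u v := by
  obtain ⟨hc, he, hd⟩ := regularParam_iff.1 h
  rw [isInvPedalPoint_iff_of_hasDerivAt (hasDerivAt_ruled_fst hc he) hasDerivAt_ruled_snd,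
    eq_pedalPt_iff hd]

/-- The envelope condition depends only on the germ of g; this allows g to be replaced by r s. -/
theorem isInvPedalPoint_congr {g g' : ℝ → ℝ → E3} {U : Set (ℝ × ℝ)} {u t : ℝ} (hU : IsOpen U)
    (h : (u, t) ∈ U) (hg : ∀ u t, (u, t) ∈ U → g u t = g' u t) (x : E3) :
    IsInvPedalPoint g u t x ↔ IsInvPedalPoint g' u t x := by
  unfold IsInvPedalPoint
  rw [hg u t h, dFst_congr hU h (g := fun u' t' => inner ℝ x (g' u' t') -
      inner ℝ (g' u' t') (g' u' t')) (fun a b hab => by simp only [hg a b hab]),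
    dSnd_congr hU h (g := fun u' t' => inner ℝ x (g' u' t') -
      inner ℝ (g' u' t') (g' u' t')) (fun a b hab => by simp only [hg a b hab])]

section Smooth

variable {E : Type*} [NormedAddCommGroup E] [NormedSpace ℝ E] {U V : E → ℝ} {p : E}

theorem contDiffAt_ruled (hc : c.RegularAt (U p)) (he : e.RegularAt (U p))
    (hU : ContDiffAt ℝ ∞ U p) (hV : ContDiffAt ℝ ∞ V p) :
    ContDiffAt ℝ ∞ (fun q => ruled c e (U q) (V q)) p :=
  ((RatCurve.contDiffAt hc).comp p hU).add (hV.smul ((RatCurve.contDiffAt he).comp p hU))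

theorem contDiffAt_ruledVel (hc : c.RegularAt (U p)) (he : e.RegularAt (U p))
    (hU : ContDiffAt ℝ ∞ U p) (hV : ContDiffAt ℝ ∞ V p) :
    ContDiffAt ℝ ∞ (fun q => ruledVel c e (U q) (V q)) p :=
  ((RatCurve.contDiffAt_deriv hc).comp p hU).add
    (hV.smul ((RatCurve.contDiffAt_deriv he).comp p hU))

theorem contDiffAt_ruledDet (hc : c.RegularAt (U p)) (he : e.RegularAt (U p))
    (hU : ContDiffAt ℝ ∞ U p) (hV : ContDiffAt ℝ ∞ V p) :
    ContDiffAt ℝ ∞ (fun q => ruledDet c e (U q) (V q)) p :=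
  (contDiffAt_ruled hc he hU hV).inner ℝ
    (contDiffAt_cross (contDiffAt_ruledVel hc he hU hV) ((RatCurve.contDiffAt he).comp p hU))

theorem contDiffAt_pedalPt (hr : RegularParam c e (U p) (V p))
    (hU : ContDiffAt ℝ ∞ U p) (hV : ContDiffAt ℝ ∞ V p) :
    ContDiffAt ℝ ∞ (fun q => pedalPt c e (U q) (V q)) p := by
  obtain ⟨hc, he, hd⟩ := regularParam_iff.1 hr
  have hg := contDiffAt_ruled hc he hU hV
  exact ((contDiffAt_const (c := (2 : ℝ))).smul hg).sub
    (((hg.inner ℝ hg).div (contDiffAt_ruledDet hc he hU hV) hd).smul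
      (contDiffAt_cross (contDiffAt_ruledVel hc he hU hV) ((RatCurve.contDiffAt he).comp p hU)))

end Smooth

/-! ### Polar representations -/

namespace IsPolarRep

variable {U : Set (ℝ × ℝ)} {v r : ℝ → ℝ → ℝ} {s : ℝ → ℝ → E3} {u t : ℝ}

theorem mono (h : IsPolarRep c e U v r s) {U' : Set (ℝ × ℝ)} (hU' : IsOpen U') (hs : U' ⊆ U) :
    IsPolarRep c e U' v r s where
  isOpen := hU'
  smooth_v := h.smooth_v.mono hs
  smooth_r := h.smooth_r.mono hs
  smooth_s := h.smooth_s.mono hs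
  regular u t hp := h.regular u t (hs hp)
  reparam u t hp := h.reparam u t (hs hp)
  unit u t hp := h.unit u t (hs hp)
  radius_ne u t hp := h.radius_ne u t (hs hp)
  polar u t hp := h.polar u t (hs hp)

variable (h : IsPolarRep c e U v r s) (hp : (u, t) ∈ U)

include h hp

theorem contDiffAt_v : ContDiffAt ℝ ∞ (fun p : ℝ × ℝ => v p.1 p.2) (u, t) :=
  h.smooth_v.contDiffAt (h.isOpen.mem_nhds hp)

theorem contDiffAt_r : ContDiffAt ℝ ∞ (fun p : ℝ × ℝ => r p.1 p.2) (u, t) :=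
  h.smooth_r.contDiffAt (h.isOpen.mem_nhds hp)

theorem contDiffAt_s : ContDiffAt ℝ ∞ (fun p : ℝ × ℝ => s p.1 p.2) (u, t) :=
  h.smooth_s.contDiffAt (h.isOpen.mem_nhds hp)

theorem v_fst : HasDerivAt (fun u' => v u' t) (dFst v u t) u :=
  hasDerivAt_dFst ((h.contDiffAt_v hp).differentiableAt (by simp))

theorem v_snd : HasDerivAt (fun t' => v u t') (dSnd v u t) t :=
  hasDerivAt_dSnd ((h.contDiffAt_v hp).differentiableAt (by simp))

theorem r_fst : HasDerivAt (fun u' => r u' t) (dFst r u t) u :=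
  hasDerivAt_dFst ((h.contDiffAt_r hp).differentiableAt (by simp))

theorem r_snd : HasDerivAt (fun t' => r u t') (dSnd r u t) t :=
  hasDerivAt_dSnd ((h.contDiffAt_r hp).differentiableAt (by simp))

theorem s_fst : HasDerivAt (fun u' => s u' t) (dFst s u t) u :=
  hasDerivAt_dFst ((h.contDiffAt_s hp).differentiableAt (by simp))

theorem s_snd : HasDerivAt (fun t' => s u t') (dSnd s u t) t :=
  hasDerivAt_dSnd ((h.contDiffAt_s hp).differentiableAt (by simp))

theorem regular_c : c.RegularAt u := (h.regular u t hp).1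

theorem regular_e : e.RegularAt u := (h.regular u t hp).2.1

theorem det_ne : ruledDet c e u (v u t) ≠ 0 := (regularParam_iff.1 (h.regular u t hp)).2.2

theorem ruled_fst : HasDerivAt (fun u' => ruled c e u' (v u' t))
    (ruledVel c e u (v u t) + dFst v u t • e.at u) u := by
  have := (RatCurve.hasDerivAt (h.regular_c hp)).add
    ((h.v_fst hp).smul (RatCurve.hasDerivAt (h.regular_e hp)))
  rw [← add_assoc] at this
  exact this

theorem ruled_snd : HasDerivAt (fun t' => ruled c e u (v u t')) (dSnd v u t • e.at u) t :=
  ((h.v_snd hp).smul_const (e.at u)).const_add (c.at u)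

theorem inner_s_s : inner ℝ (s u t) (s u t) = 1 := by
  rw [real_inner_self_eq_norm_sq, h.unit u t hp, one_pow]

theorem inner_s_dFst : inner ℝ (s u t) (dFst s u t) = 0 := by
  have := hasDerivAt_unique_of_eventuallyEq ((h.s_fst hp).inner ℝ (h.s_fst hp))
    (hasDerivAt_const u (1 : ℝ)) ((eventually_fst h.isOpen hp).mono fun _ hu => h.inner_s_s hu)
  rw [real_inner_comm (s u t) (dFst s u t)] at this
  linarith

theorem inner_s_dSnd : inner ℝ (s u t) (dSnd s u t) = 0 := by
  have := hasDerivAt_unique_of_eventuallyEq ((h.s_snd hp).inner ℝ (h.s_snd hp))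
    (hasDerivAt_const t (1 : ℝ)) ((eventually_snd h.isOpen hp).mono fun _ hu => h.inner_s_s hu)
  rw [real_inner_comm (s u t) (dSnd s u t)] at this
  linarith

theorem polar_snd : dSnd v u t • e.at u = r u t • dSnd s u t + dSnd r u t • s u t :=
  hasDerivAt_unique_of_eventuallyEq (h.ruled_snd hp) ((h.r_snd hp).smul (h.s_snd hp))
    ((eventually_snd h.isOpen hp).mono fun _ ht => h.polar _ _ ht)

/-- Reparametrizing the rulings recombines the two derived equations by a triangular matrix with
diagonal 1, v_t, which is invertible. -/
theorem isInvPedalPoint_iff_eq_pedalPt (x : E3) :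
    IsInvPedalPoint (fun u' t' => ruled c e u' (v u' t')) u t x ↔ x = pedalPt c e u (v u t) := by
  rw [isInvPedalPoint_iff_of_hasDerivAt (h.ruled_fst hp) (h.ruled_snd hp),
    eq_pedalPt_iff (h.det_ne hp)]
  refine and_congr_right fun _ => ?_
  simp only [inner_add_right, real_inner_smul_right]
  have hv := h.reparam u t hp
  constructor
  · rintro ⟨h1, h2⟩
    have h3 : inner ℝ x (e.at u) = 2 * inner ℝ (ruled c e u (v u t)) (e.at u) :=
      mul_left_cancel₀ hv (by linear_combination h2)
    exact ⟨by linear_combination h1 - dFst v u t * h3, h3⟩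
  · rintro ⟨h1, h2⟩
    exact ⟨by linear_combination h1 + dFst v u t * h2, by linear_combination dSnd v u t * h2⟩

/-- The support function form of the envelope equations: once x·s = r + d is known, the derived
equations reduce to multiples of r + d. The distance d survives in the first equation only. -/
theorem isInvPedalPoint_conchoid_iff {d : ℝ} (hd : r u t + d ≠ 0) (x : E3) :
    IsInvPedalPoint (conchoid r s d) u t x ↔ inner ℝ x (s u t) = r u t + d ∧
      inner ℝ x (dFst s u t) = dFst r u t ∧ inner ℝ x (dSnd s u t) = dSnd r u t := by
  have h1 : HasDerivAt (fun u' => conchoid r s d u' t) _ u :=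
    ((h.r_fst hp).add_const d).smul (h.s_fst hp)
  have h2 : HasDerivAt (fun t' => conchoid r s d u t') _ t :=
    ((h.r_snd hp).add_const d).smul (h.s_snd hp)
  rw [isInvPedalPoint_iff_of_hasDerivAt h1 h2]
  simp only [conchoid, inner_add_right, real_inner_smul_right, real_inner_smul_left,
    h.inner_s_s hp, h.inner_s_dFst hp, h.inner_s_dSnd hp]
  constructor
  · rintro ⟨h1, h2, h3⟩
    have h4 : inner ℝ x (s u t) = r u t + d := mul_left_cancel₀ hd (by linear_combination h1)
    refine ⟨h4, mul_left_cancel₀ hd ?_, mul_left_cancel₀ hd ?_⟩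
    · linear_combination h2 - dFst r u t * h4
    · linear_combination h3 - dSnd r u t * h4
  · rintro ⟨h1, h2, h3⟩
    refine ⟨?_, ?_, ?_⟩
    · linear_combination (r u t + d) * h1
    · linear_combination (r u t + d) * h2 + dFst r u t * h1
    · linear_combination (r u t + d) * h3 + dSnd r u t * h1

theorem eq_offset_iff (d : ℝ) (x : E3) :
    x = offset (fun u t => pedalPt c e u (v u t)) s d u t ↔ inner ℝ x (s u t) = r u t + d ∧
      inner ℝ x (dFst s u t) = dFst r u t ∧ inner ℝ x (dSnd s u t) = dSnd r u t := by
  -- The conchoid at distance 0 is the ruled surface itself. Its system is applied to x - d s; the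
  -- shift is invisible to s_u and s_t.
  have hr0 : r u t + 0 ≠ 0 := by simpa using h.radius_ne u t hp
  have key := (h.isInvPedalPoint_iff_eq_pedalPt hp (x - d • s u t)).symm.trans
    ((isInvPedalPoint_congr h.isOpen hp (g' := conchoid r s 0)
      (fun u t hp => by simp [conchoid, h.polar u t hp]) _).trans
        (h.isInvPedalPoint_conchoid_iff hp hr0 _))
  rw [offset, ← sub_eq_iff_eq_add, key]
  simp only [inner_sub_left, real_inner_smul_left, h.inner_s_s hp, h.inner_s_dFst hp,
    h.inner_s_dSnd hp, mul_one, mul_zero, sub_zero, add_zero, sub_eq_iff_eq_add]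

theorem contDiffAt_pedalPt :
    ContDiffAt ℝ ∞ (fun p : ℝ × ℝ => pedalPt c e p.1 (v p.1 p.2)) (u, t) :=
  PedalGeom.contDiffAt_pedalPt (U := Prod.fst) (V := fun p : ℝ × ℝ => v p.1 p.2) (p := (u, t))
    (h.regular u t hp) contDiffAt_fst (h.contDiffAt_v hp)

theorem offset_fst (d : ℝ) :
    HasDerivAt (fun u' => offset (fun u t => pedalPt c e u (v u t)) s d u' t)
      (dFst (offset (fun u t => pedalPt c e u (v u t)) s d) u t) u :=
  hasDerivAt_dFst (((h.contDiffAt_pedalPt hp).add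
    ((contDiffAt_const (c := d)).smul (h.contDiffAt_s hp))).differentiableAt (by simp))

theorem offset_snd (d : ℝ) :
    HasDerivAt (fun t' => offset (fun u t => pedalPt c e u (v u t)) s d u t')
      (dSnd (offset (fun u t => pedalPt c e u (v u t)) s d) u t) t :=
  hasDerivAt_dSnd (((h.contDiffAt_pedalPt hp).add
    ((contDiffAt_const (c := d)).smul (h.contDiffAt_s hp))).differentiableAt (by simp))

theorem inner_offset (d : ℝ) :
    inner ℝ (offset (fun u t => pedalPt c e u (v u t)) s d u t) (s u t) = r u t + d :=
  ((h.eq_offset_iff hp d _).1 rfl).1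

omit hp in
-- Differentiate f_d·s = r + d and subtract f_d·s_u = r_u, respectively f_d·s_t = r_t.
theorem isUnitNormalOn_offset (d : ℝ) :
    IsUnitNormalOn (offset (fun u t => pedalPt c e u (v u t)) s d) s U := by
  intro u t hp
  obtain ⟨-, h2, h3⟩ := (h.eq_offset_iff hp d _).1 rfl
  refine ⟨h.unit u t hp, ?_, ?_⟩
  · have := hasDerivAt_unique_of_eventuallyEq ((h.offset_fst hp d).inner ℝ (h.s_fst hp))
      ((h.r_fst hp).add_const d)
      ((eventually_fst h.isOpen hp).mono fun _ hu => h.inner_offset hu d)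
    rw [real_inner_comm]
    linarith
  · have := hasDerivAt_unique_of_eventuallyEq ((h.offset_snd hp d).inner ℝ (h.s_snd hp))
      ((h.r_snd hp).add_const d)
      ((eventually_snd h.isOpen hp).mono fun _ hu => h.inner_offset hu d)
    rw [real_inner_comm]
    linarith

omit hp in
theorem isUnitNormalOn_pedalPt : IsUnitNormalOn (fun u t => pedalPt c e u (v u t)) s U := by
  have h0 : offset (fun u t => pedalPt c e u (v u t)) s 0 = fun u t => pedalPt c e u (v u t) := by
    ext1 u
    ext1 t
    simp [offset]
  exact h0 ▸ h.isUnitNormalOn_offset 0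

end IsPolarRep

/-! ### Parabolas and parabolic cylinders -/

section Parabola

variable {c e : RatCurve} {u : ℝ}

theorem axisDir_eq (c e : RatCurve) (u : ℝ) : axisDir c e u = cross (c.at u) (e.at u) := by
  apply ext3 <;>
  simp only [axisDir, foot, cross_zero, cross_one, cross_two, PiLp.sub_apply, PiLp.smul_apply,
    smul_eq_mul] <;> ring

theorem cross_ruled_dir (c e : RatCurve) (u v : ℝ) :
    cross (ruled c e u v) (e.at u) = axisDir c e u := by
  rw [axisDir_eq]
  apply ext3 <;>
  simp only [ruled, cross_zero, cross_one, cross_two, PiLp.add_apply, PiLp.smul_apply,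
    smul_eq_mul] <;> ring

theorem inner_dir_self_ne_zero (h : axisDir c e u ≠ 0) : inner ℝ (e.at u) (e.at u) ≠ 0 := by
  intro h0
  apply h
  have := eq_zero_of_inner_self h0
  apply ext3 <;> simp [axisDir, this]

theorem inner_foot_self_ne_zero (h : axisDir c e u ≠ 0) :
    inner ℝ (foot c e u) (foot c e u) ≠ 0 := by
  intro h0
  apply h
  have := eq_zero_of_inner_self h0
  apply ext3 <;> simp [axisDir, this]

theorem inner_foot_dir (h : axisDir c e u ≠ 0) : inner ℝ (foot c e u) (e.at u) = 0 := by
  rw [foot, inner_sub_left, real_inner_smul_left, div_mul_cancel₀ _ (inner_dir_self_ne_zero h),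
    sub_self]

theorem ruled_eq_foot_add (c e : RatCurve) (u v : ℝ) : ruled c e u v = foot c e u +
    (v + inner ℝ (c.at u) (e.at u) / inner ℝ (e.at u) (e.at u)) • e.at u := by
  rw [ruled, foot]; module

/-- Together with `inner_parabolaPoint_ruled`: the parabola point satisfies those two of the three
equations of `eq_pedalPt_iff` that involve no derivative of the ruling. Hence it differs from the
envelope point only in the direction of the generator. -/
theorem inner_parabolaPoint_dir (h : axisDir c e u ≠ 0) (v : ℝ) :
    inner ℝ (parabolaPoint c e u v) (e.at u) = 2 * inner ℝ (ruled c e u v) (e.at u) := by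
  rw [ruled_eq_foot_add, parabolaPoint]
  simp only [inner_add_left, real_inner_smul_left, inner_foot_dir h]
  ring

theorem inner_parabolaPoint_ruled (h : axisDir c e u ≠ 0) (v : ℝ) :
    inner ℝ (parabolaPoint c e u v) (ruled c e u v) =
      inner ℝ (ruled c e u v) (ruled c e u v) := by
  rw [ruled_eq_foot_add, parabolaPoint]
  simp only [inner_add_left, inner_add_right, real_inner_smul_left, real_inner_smul_right,
    inner_foot_dir h, real_inner_comm (foot c e u) (e.at u)]
  have := inner_foot_self_ne_zero h
  field_simp
  ring

theorem foot_mem_sectionPlane (c e : RatCurve) (u : ℝ) : foot c e u ∈ sectionPlane c e u :=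
  Submodule.sub_mem _ (Submodule.subset_span (by simp))
    (Submodule.smul_mem _ _ (Submodule.subset_span (by simp)))

theorem dir_mem_sectionPlane (c e : RatCurve) (u : ℝ) : e.at u ∈ sectionPlane c e u :=
  Submodule.subset_span (by simp)

theorem parabolaPoint_mem_sectionPlane (c e : RatCurve) (u v : ℝ) :
    parabolaPoint c e u v ∈ sectionPlane c e u :=
  Submodule.add_mem _ (Submodule.smul_mem _ _ (foot_mem_sectionPlane c e u))
    (Submodule.smul_mem _ _ (dir_mem_sectionPlane c e u))

theorem ruled_mem_sectionPlane (c e : RatCurve) (u v : ℝ) :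
    ruled c e u v ∈ sectionPlane c e u :=
  Submodule.add_mem _ (Submodule.subset_span (by simp))
    (Submodule.smul_mem _ _ (dir_mem_sectionPlane c e u))

theorem inner_axisDir_of_mem {x : E3} (hx : x ∈ sectionPlane c e u) :
    inner ℝ x (axisDir c e u) = 0 := by
  obtain ⟨a, b, rfl⟩ := Submodule.mem_span_pair.1 hx
  rw [axisDir_eq, inner_add_left, real_inner_smul_left, real_inner_smul_left, inner_left_cross,
    inner_right_cross]
  simp

theorem contDiffAt_foot (hc : c.RegularAt u) (he : e.RegularAt u) (h : axisDir c e u ≠ 0) :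
    ContDiffAt ℝ ∞ (foot c e) u :=
  (RatCurve.contDiffAt hc).sub ((((RatCurve.contDiffAt hc).inner ℝ (RatCurve.contDiffAt he)).div
    ((RatCurve.contDiffAt he).inner ℝ (RatCurve.contDiffAt he)) (inner_dir_self_ne_zero h)).smul
      (RatCurve.contDiffAt he))

theorem contDiffAt_axisDir (hc : c.RegularAt u) (he : e.RegularAt u) (h : axisDir c e u ≠ 0) :
    ContDiffAt ℝ ∞ (axisDir c e) u :=
  contDiffAt_cross (contDiffAt_foot hc he h) (RatCurve.contDiffAt he)

theorem contDiffAt_parabolaPoint {E : Type*} [NormedAddCommGroup E] [NormedSpace ℝ E]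
    {U V : E → ℝ} {p : E} (hc : c.RegularAt (U p)) (he : e.RegularAt (U p))
    (h : axisDir c e (U p) ≠ 0) (hU : ContDiffAt ℝ ∞ U p) (hV : ContDiffAt ℝ ∞ V p) :
    ContDiffAt ℝ ∞ (fun q => parabolaPoint c e (U q) (V q)) p := by
  have hC := (RatCurve.contDiffAt hc).comp p hU
  have hE := (RatCurve.contDiffAt he).comp p hU
  have hF := (contDiffAt_foot hc he h).comp p hU
  have hee := hE.inner ℝ hE
  have hk := hV.add ((hC.inner ℝ hE).div hee (inner_dir_self_ne_zero h))
  exact (((contDiffAt_const (c := (1 : ℝ))).sub (((hk.pow 2).mul hee).div (hF.inner ℝ hF)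
    (inner_foot_self_ne_zero h))).smul hF).add (((contDiffAt_const (c := (2 : ℝ))).mul hk).smul hE)

end Parabola

/-! ### Parabolas and cylinders along a polar representation -/

namespace IsPolarRep

variable {c e : RatCurve} {U : Set (ℝ × ℝ)} {v r : ℝ → ℝ → ℝ} {s : ℝ → ℝ → E3} {u t : ℝ}
  (h : IsPolarRep c e U v r s) (hp : (u, t) ∈ U)

include h hp

theorem axisDir_ne : axisDir c e u ≠ 0 := by
  rw [axisDir_eq]; exact cross_ne_zero_of_ruledDet_ne (h.det_ne hp)

theorem s_eq : s u t = (r u t)⁻¹ • ruled c e u (v u t) := by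
  rw [h.polar u t hp, smul_smul, inv_mul_cancel₀ (h.radius_ne u t hp), one_smul]

theorem s_mem : s u t ∈ sectionPlane c e u := by
  rw [h.s_eq hp]; exact Submodule.smul_mem _ _ (ruled_mem_sectionPlane _ _ _ _)

theorem s_ne : s u t ≠ 0 := by
  intro h0
  have := h.unit u t hp
  simp [h0] at this

theorem dSnd_r_eq : dSnd r u t = dSnd v u t * inner ℝ (s u t) (e.at u) := by
  have := congrArg (inner ℝ (s u t)) (h.polar_snd hp)
  rw [inner_add_right, real_inner_smul_right, real_inner_smul_right, real_inner_smul_right,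
    h.inner_s_s hp, h.inner_s_dSnd hp] at this
  linarith

theorem dSnd_s_eq :
    dSnd s u t = (r u t)⁻¹ • (dSnd v u t • e.at u - dSnd r u t • s u t) := by
  rw [h.polar_snd hp, add_sub_cancel_right, smul_smul, inv_mul_cancel₀ (h.radius_ne u t hp),
    one_smul]

theorem dSnd_s_mem : dSnd s u t ∈ sectionPlane c e u := by
  rw [h.dSnd_s_eq hp]
  exact Submodule.smul_mem _ _ (Submodule.sub_mem _
    (Submodule.smul_mem _ _ (dir_mem_sectionPlane _ _ _)) (Submodule.smul_mem _ _ (h.s_mem hp)))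

theorem inner_parabolaPoint_s : inner ℝ (parabolaPoint c e u (v u t)) (s u t) = r u t := by
  have hr := h.radius_ne u t hp
  have := inner_parabolaPoint_ruled (h.axisDir_ne hp) (v u t)
  rw [h.polar u t hp, real_inner_smul_right, real_inner_smul_right, real_inner_smul_left,
    h.inner_s_s hp, mul_one] at this
  exact mul_left_cancel₀ hr this

/-- With `inner_parabolaPoint_s` this makes the parabola the envelope of the lines x·s = r in its
plane, so that s is its normal. -/
theorem inner_parabolaPoint_dSnd_s :
    inner ℝ (parabolaPoint c e u (v u t)) (dSnd s u t) = dSnd r u t := by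
  have hr := h.radius_ne u t hp
  have h1 := inner_parabolaPoint_dir (h.axisDir_ne hp) (v u t)
  rw [h.polar u t hp, real_inner_smul_left] at h1
  rw [h.dSnd_s_eq hp, real_inner_smul_right, inner_sub_right, real_inner_smul_right,
    real_inner_smul_right, h.inner_parabolaPoint_s hp, h1]
  have h2 := h.dSnd_r_eq hp
  field_simp
  linear_combination (-2) * h2

theorem contDiffAt_parabolaPoint :
    ContDiffAt ℝ ∞ (fun p : ℝ × ℝ => parabolaPoint c e p.1 (v p.1 p.2)) (u, t) :=
  PedalGeom.contDiffAt_parabolaPoint (U := Prod.fst) (V := fun p : ℝ × ℝ => v p.1 p.2)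
    (p := (u, t)) (h.regular_c hp) (h.regular_e hp) (h.axisDir_ne hp) contDiffAt_fst
    (h.contDiffAt_v hp)

theorem parabolaPoint_fst : HasDerivAt (fun u' => parabolaPoint c e u' (v u' t))
    (dFst (fun u' t' => parabolaPoint c e u' (v u' t')) u t) u :=
  hasDerivAt_dFst (f := fun u' t' => parabolaPoint c e u' (v u' t'))
    ((h.contDiffAt_parabolaPoint hp).differentiableAt (by simp))

theorem parabolaPoint_snd : HasDerivAt (fun t' => parabolaPoint c e u (v u t'))
    (dSnd (fun u' t' => parabolaPoint c e u' (v u' t')) u t) t :=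
  hasDerivAt_dSnd (f := fun u' t' => parabolaPoint c e u' (v u' t'))
    ((h.contDiffAt_parabolaPoint hp).differentiableAt (by simp))

/-- The component along the ruling alone shows that the tangent vector of the parabola does not
vanish. -/
theorem inner_dSnd_parabolaPoint_dir :
    inner ℝ (dSnd (fun u' t' => parabolaPoint c e u' (v u' t')) u t) (e.at u) =
      2 * dSnd v u t * inner ℝ (e.at u) (e.at u) := by
  have := hasDerivAt_unique_of_eventuallyEq
    ((h.parabolaPoint_snd hp).inner ℝ (hasDerivAt_const t (e.at u)))
    (((h.ruled_snd hp).inner ℝ (hasDerivAt_const t (e.at u))).const_mul 2)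
    ((eventually_snd h.isOpen hp).mono fun _ ht => inner_parabolaPoint_dir (h.axisDir_ne ht) _)
  simp only [inner_zero_right, zero_add, real_inner_smul_left] at this
  linarith

theorem dSnd_parabolaPoint_ne : dSnd (fun u' t' => parabolaPoint c e u' (v u' t')) u t ≠ 0 := by
  intro h0
  have := h.inner_dSnd_parabolaPoint_dir hp
  rw [h0, inner_zero_left] at this
  have h1 := h.reparam u t hp
  have h2 := inner_dir_self_ne_zero (h.axisDir_ne hp)
  simp_all

theorem inner_s_dSnd_parabolaPoint :
    inner ℝ (s u t) (dSnd (fun u' t' => parabolaPoint c e u' (v u' t')) u t) = 0 := by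
  have := hasDerivAt_unique_of_eventuallyEq
    ((h.parabolaPoint_snd hp).inner ℝ (h.s_snd hp)) (h.r_snd hp)
    ((eventually_snd h.isOpen hp).mono fun _ ht => h.inner_parabolaPoint_s ht)
  rw [h.inner_parabolaPoint_dSnd_s hp] at this
  rw [real_inner_comm]
  linarith

theorem inner_dSnd_parabolaPoint_axisDir :
    inner ℝ (dSnd (fun u' t' => parabolaPoint c e u' (v u' t')) u t) (axisDir c e u) = 0 := by
  have := hasDerivAt_unique_of_eventuallyEq
    ((h.parabolaPoint_snd hp).inner ℝ (hasDerivAt_const t (axisDir c e u)))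
    (hasDerivAt_const t (0 : ℝ))
    (.of_forall fun _ => inner_axisDir_of_mem (parabolaPoint_mem_sectionPlane _ _ _ _))
  simpa using this

theorem inner_s_axisDir : inner ℝ (s u t) (axisDir c e u) = 0 :=
  inner_axisDir_of_mem (h.s_mem hp)

omit hp in
-- The parabola and s lie in the section plane and the generators are orthogonal to it, so a point
-- of the section has `l = 0`.
theorem crossSection_eq (d u : ℝ) :
    {x | x ∈ sectionPlane c e u ∧ ∃ t l, (u, t) ∈ U ∧ x = offsetCylinder c e v s d u t l} =
      {x | ∃ t, (u, t) ∈ U ∧ x = parabolaPoint c e u (v u t) + d • s u t} := by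
  ext x
  constructor
  · rintro ⟨hx, t, l, hp, rfl⟩
    refine ⟨t, hp, ?_⟩
    have h1 := inner_axisDir_of_mem hx
    rw [offsetCylinder, inner_add_left, inner_add_left, real_inner_smul_left,
      real_inner_smul_left, h.inner_s_axisDir hp,
      inner_axisDir_of_mem (parabolaPoint_mem_sectionPlane _ _ _ _)] at h1
    have h3 : l = 0 := by simpa [h.axisDir_ne hp] using h1
    simp [offsetCylinder, h3]
  · rintro ⟨t, hp, rfl⟩
    exact ⟨Submodule.add_mem _ (parabolaPoint_mem_sectionPlane _ _ _ _)
      (Submodule.smul_mem _ _ (h.s_mem hp)), t, 0, hp, by simp [offsetCylinder]⟩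

/-! ### The offset cylinders and their envelope -/

theorem cylinder_fst (d l : ℝ) : HasDerivAt (fun u' => offsetCylinder c e v s d u' t l)
    (dFst (fun u' t' => parabolaPoint c e u' (v u' t')) u t + l • deriv (axisDir c e) u +
      d • dFst s u t) u :=
  ((h.parabolaPoint_fst hp).add (((contDiffAt_axisDir (h.regular_c hp) (h.regular_e hp)
    (h.axisDir_ne hp)).differentiableAt (by simp)).hasDerivAt.const_smul l)).add
      ((h.s_fst hp).const_smul d)

theorem cylinder_snd (d l : ℝ) : HasDerivAt (fun t' => offsetCylinder c e v s d u t' l)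
    (dSnd (fun u' t' => parabolaPoint c e u' (v u' t')) u t + d • dSnd s u t) t :=
  ((h.parabolaPoint_snd hp).add_const _).add ((h.s_snd hp).const_smul d)

omit h hp in
theorem cylinder_thd (d l : ℝ) :
    HasDerivAt (fun l' => offsetCylinder c e v s d u t l') (axisDir c e u) l := by
  have := (((hasDerivAt_id l).smul_const (axisDir c e u)).const_add
    (parabolaPoint c e u (v u t))).add_const (d • s u t)
  rwa [one_smul] at this

theorem inner_cylinder_s (d l : ℝ) :
    inner ℝ (offsetCylinder c e v s d u t l) (s u t) = r u t + d := by
  rw [offsetCylinder, inner_add_left, inner_add_left, real_inner_smul_left, real_inner_smul_left,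
    h.inner_s_s hp, h.inner_parabolaPoint_s hp, real_inner_comm (s u t) (axisDir c e u),
    h.inner_s_axisDir hp]
  ring

theorem inner_cylinder_dSnd_s (d l : ℝ) :
    inner ℝ (offsetCylinder c e v s d u t l) (dSnd s u t) = dSnd r u t := by
  rw [offsetCylinder, inner_add_left, inner_add_left, real_inner_smul_left, real_inner_smul_left,
    h.inner_s_dSnd hp, h.inner_parabolaPoint_dSnd_s hp,
    real_inner_comm (dSnd s u t) (axisDir c e u), inner_axisDir_of_mem (h.dSnd_s_mem hp)]
  ring

theorem inner_s_cylinder_snd (d l : ℝ) :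
    inner ℝ (s u t) (deriv (fun t' => offsetCylinder c e v s d u t' l) t) = 0 := by
  rw [(h.cylinder_snd hp d l).deriv, inner_add_right, real_inner_smul_right,
    h.inner_s_dSnd_parabolaPoint hp, h.inner_s_dSnd hp]
  ring

theorem inner_s_cylinder_thd (d l : ℝ) :
    inner ℝ (s u t) (deriv (fun l' => offsetCylinder c e v s d u t l') l) = 0 := by
  rw [(cylinder_thd d l).deriv, h.inner_s_axisDir hp]

/-- Differentiate q·s = r + d with respect to u, for fixed t and l. -/
theorem inner_s_cylinder_fst (d l : ℝ) :
    inner ℝ (s u t) (deriv (fun u' => offsetCylinder c e v s d u' t l) u) =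
      dFst r u t - inner ℝ (offsetCylinder c e v s d u t l) (dFst s u t) := by
  have := hasDerivAt_unique_of_eventuallyEq ((h.cylinder_fst hp d l).inner ℝ (h.s_fst hp))
    ((h.r_fst hp).add_const d)
    ((eventually_fst h.isOpen hp).mono fun _ hu => h.inner_cylinder_s hu d l)
  rw [(h.cylinder_fst hp d l).deriv, real_inner_comm]
  linarith

/-- Every point of the generator satisfies x·s = r + d and x·s_t = r_t. Dependence of the three
partial derivatives means s·q_u = 0, which is the missing equation q·s_u = r_u. -/
theorem characteristic_iff {d l : ℝ} (hm : MemberRegular (offsetCylinder c e v s d) u t l) :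
    Characteristic (offsetCylinder c e v s d) u t l ↔
      offsetCylinder c e v s d u t l =
        offset (fun u t => pedalPt c e u (v u t)) s d u t := by
  rw [Characteristic, linearIndependent_triple_iff_inner_normal hm (h.s_ne hp)
    (h.inner_s_cylinder_snd hp d l) (h.inner_s_cylinder_thd hp d l), not_not,
    h.inner_s_cylinder_fst hp, h.eq_offset_iff hp, h.inner_cylinder_s hp,
    h.inner_cylinder_dSnd_s hp]
  rw [sub_eq_zero, eq_comm]
  simp

/-- The envelope point and the parabola point have equal inner products with g and e, so their
difference is a multiple of g × e. Adding d s to both does not change it. -/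
theorem exists_cylinder_eq (d : ℝ) : ∃ l, offsetCylinder c e v s d u t l =
    offset (fun u t => pedalPt c e u (v u t)) s d u t := by
  have hA := h.axisDir_ne hp
  rw [← cross_ruled_dir c e u (v u t)] at hA
  obtain ⟨l, hl⟩ := eq_smul_cross hA
    (y := pedalPt c e u (v u t) - parabolaPoint c e u (v u t))
    (by rw [inner_sub_left, inner_pedalPt_ruled (h.det_ne hp),
      inner_parabolaPoint_ruled (h.axisDir_ne hp), sub_self])
    (by rw [inner_sub_left, inner_pedalPt_dir, inner_parabolaPoint_dir (h.axisDir_ne hp),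
      sub_self])
  rw [cross_ruled_dir] at hl
  refine ⟨l, ?_⟩
  rw [offsetCylinder, offset, ← hl]
  abel

/-- The derivative in t is orthogonal to the axis, so regularity can fail only if this derivative
vanishes; it does not depend on `l`. -/
theorem memberRegular_of_ne {d : ℝ}
    (hq : dSnd (fun u' t' => parabolaPoint c e u' (v u' t')) u t + d • dSnd s u t ≠ 0) (l : ℝ) :
    MemberRegular (offsetCylinder c e v s d) u t l := by
  rw [MemberRegular, (h.cylinder_snd hp d l).deriv, (cylinder_thd d l).deriv,
    linearIndependent_pair_iff]
  intro h0
  have h1 := inner_cross_self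
    (dSnd (fun u' t' => parabolaPoint c e u' (v u' t')) u t + d • dSnd s u t) (axisDir c e u)
  rw [h0, inner_add_left _ _ (axisDir c e u), real_inner_smul_left,
    h.inner_dSnd_parabolaPoint_axisDir hp, inner_axisDir_of_mem (h.dSnd_s_mem hp)] at h1
  simp [hq, h.axisDir_ne hp] at h1

/-- The radius at a parameter at which the offset of the parabola is singular. -/
theorem radius_eq_of_eq_zero {d : ℝ}
    (hq : dSnd (fun u' t' => parabolaPoint c e u' (v u' t')) u t + d • dSnd s u t = 0) :
    2 * inner ℝ (e.at u) (e.at u) * r u t ^ 3 +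
      d * inner ℝ (axisDir c e u) (axisDir c e u) = 0 := by
  have hv := h.reparam u t hp
  have hr := h.radius_ne u t hp
  have h1 := congrArg (fun x => inner ℝ x (e.at u)) hq
  simp only [inner_add_left, real_inner_smul_left, inner_zero_left,
    h.inner_dSnd_parabolaPoint_dir hp] at h1
  rw [h.dSnd_s_eq hp, real_inner_smul_left, inner_sub_left, real_inner_smul_left,
    real_inner_smul_left, h.dSnd_r_eq hp] at h1
  -- Here |axis|² = |g|²|e|² - (g·e)² = r²(|e|² - (s·e)²). As |axis|² = |foot|²|e|², the claim says
  -- that d is minus the signed radius of curvature 2r³/|foot|² of the parabola.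
  rw [← cross_ruled_dir c e u (v u t), inner_cross_self, h.polar u t hp]
  simp only [real_inner_smul_left, real_inner_smul_right, h.inner_s_s hp]
  apply mul_left_cancel₀ hv
  field_simp at h1
  linear_combination r u t ^ 2 * h1

/-- If regularity failed for all t' near t, r³ and hence r would be constant there by
`radius_eq_of_eq_zero`. Then r_t = 0 makes g orthogonal to e on an interval, although the derivative
of g·e is v_t |e|² ≠ 0. -/
theorem mem_closure_memberRegular (d : ℝ) :
    (u, t) ∈ closure {p | p ∈ U ∧ ∀ l, MemberRegular (offsetCylinder c e v s d) p.1 p.2 l} := by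
  by_contra hcon
  rw [mem_closure_iff_frequently, Filter.not_frequently] at hcon
  have hcont : ContinuousAt (fun t' : ℝ => (u, t')) t := by fun_prop
  have hU := eventually_snd h.isOpen hp
  have hee := inner_dir_self_ne_zero (h.axisDir_ne hp)
  have h1 : ∀ᶠ t' in nhds t, 2 * inner ℝ (e.at u) (e.at u) * r u t' ^ 3 +
      d * inner ℝ (axisDir c e u) (axisDir c e u) = 0 := by
    filter_upwards [hcont.eventually hcon, hU] with t' ht' hp'
    apply h.radius_eq_of_eq_zero hp'
    by_contra hq
    exact ht' ⟨hp', h.memberRegular_of_ne hp' hq⟩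
  have h2 : ∀ᶠ t' in nhds t, r u t' = r u t := by
    have h0 := h1.self_of_nhds
    filter_upwards [h1] with t' ht'
    have h3 : r u t' ^ 3 = r u t ^ 3 :=
      mul_left_cancel₀ (mul_ne_zero two_ne_zero hee) (by linear_combination ht' - h0)
    exact (Odd.strictMono_pow (by decide)).injective h3
  have h3 : ∀ᶠ t' in nhds t, inner ℝ (ruled c e u (v u t')) (e.at u) = 0 := by
    filter_upwards [h2.eventually_nhds, hU] with t' ht' hp'
    have h4 : dSnd r u t' = 0 :=
      hasDerivAt_unique_of_eventuallyEq (h.r_snd hp') (hasDerivAt_const t' (r u t)) ht'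
    have h5 := h.dSnd_r_eq hp'
    rw [h4, eq_comm, mul_eq_zero, or_iff_right (h.reparam u t' hp')] at h5
    rw [h.polar u t' hp', real_inner_smul_left, h5, mul_zero]
  have h4 := hasDerivAt_unique_of_eventuallyEq
    ((h.ruled_snd hp).inner ℝ (hasDerivAt_const t (e.at u))) (hasDerivAt_const t (0 : ℝ)) h3
  rw [inner_zero_right, zero_add, real_inner_smul_left] at h4
  exact mul_ne_zero (h.reparam u t hp) hee h4

omit hp in
theorem isEnvelopeOn (d : ℝ) : IsEnvelopeOn (offsetCylinder c e v s d)
    (offset (fun u t => pedalPt c e u (v u t)) s d) U where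
  generic := fun _ hp => h.mem_closure_memberRegular hp d
  mem _ _ hp := h.exists_cylinder_eq hp d
  characteristic _ _ hp _ hm := h.characteristic_iff hp hm
  tangent u t hp l hm _ := by
    obtain ⟨-, h1, h2⟩ := h.isUnitNormalOn_offset d u t hp
    exact ⟨mem_span_pair_of_inner hm (h.s_ne hp) (h.inner_s_cylinder_snd hp d l)
      (h.inner_s_cylinder_thd hp d l) h1, mem_span_pair_of_inner hm (h.s_ne hp)
      (h.inner_s_cylinder_snd hp d l) (h.inner_s_cylinder_thd hp d l) h2⟩

end IsPolarRep

/-! ### Equations of the parabolas and of the parabolic cylinders -/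

section ParabolaEquation

variable {c e : RatCurve} {u : ℝ}

theorem mem_sectionPlane_iff {x : E3} :
    x ∈ sectionPlane c e u ↔ ∃ a b : ℝ, x = a • foot c e u + b • e.at u := by
  constructor
  · intro hx
    obtain ⟨a, b, rfl⟩ := Submodule.mem_span_pair.1 hx
    exact ⟨a, b + a * (inner ℝ (c.at u) (e.at u) / inner ℝ (e.at u) (e.at u)), by
      rw [foot]; module⟩
  · rintro ⟨a, b, rfl⟩
    exact Submodule.add_mem _ (Submodule.smul_mem _ _ (foot_mem_sectionPlane c e u))
      (Submodule.smul_mem _ _ (dir_mem_sectionPlane c e u))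

/-- By Pythagoras the nearest point of the directrix has the same component along the ruling. -/
theorem infDist_directrix (h : axisDir c e u ≠ 0) (a b : ℝ) :
    Metric.infDist (a • foot c e u + b • e.at u)
      {z | ∃ k : ℝ, z = (2 : ℝ) • foot c e u + k • e.at u} = ‖(a - 2) • foot c e u‖ := by
  have hne : {z : E3 | ∃ k : ℝ, z = (2 : ℝ) • foot c e u + k • e.at u}.Nonempty := ⟨_, 0, rfl⟩
  apply le_antisymm
  · have hb : (2 : ℝ) • foot c e u + b • e.at u ∈
        {z : E3 | ∃ k : ℝ, z = (2 : ℝ) • foot c e u + k • e.at u} := ⟨b, rfl⟩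
    refine (Metric.infDist_le_dist_of_mem hb).trans_eq ?_
    rw [dist_eq_norm]
    congr 1
    module
  · rw [Metric.le_infDist hne]
    rintro _ ⟨k, rfl⟩
    rw [dist_eq_norm, show a • foot c e u + b • e.at u - ((2 : ℝ) • foot c e u + k • e.at u) =
      (a - 2) • foot c e u + (b - k) • e.at u by module]
    apply le_of_sq_le_sq _ (norm_nonneg _)
    rw [norm_add_sq_real, real_inner_smul_left, real_inner_smul_right, inner_foot_dir h]
    nlinarith [sq_nonneg ‖(b - k) • e.at u‖]

/-- The squared distances to focus and directrix are a²|foot|² + b²|e|² and (a - 2)²|foot|². -/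
theorem mem_parabola_iff (h : axisDir c e u ≠ 0) (a b : ℝ) :
    a • foot c e u + b • e.at u ∈ parabola c e u ↔
      b ^ 2 * inner ℝ (e.at u) (e.at u) =
        4 * (1 - a) * inner ℝ (foot c e u) (foot c e u) := by
  rw [parabola, Set.mem_ofPred_eq, and_iff_right (mem_sectionPlane_iff.2 ⟨a, b, rfl⟩),
    infDist_directrix h, dist_zero_right, ← sq_eq_sq₀ (norm_nonneg _) (norm_nonneg _),
    ← real_inner_self_eq_norm_sq, ← real_inner_self_eq_norm_sq]
  simp only [inner_add_left, inner_add_right, real_inner_smul_left, real_inner_smul_right,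
    inner_foot_dir h, real_inner_comm (foot c e u) (e.at u)]
  constructor <;> intro h' <;> linear_combination h'

theorem range_parabolaPoint (h : axisDir c e u ≠ 0) :
    Set.range (parabolaPoint c e u) = parabola c e u := by
  have hd := inner_foot_self_ne_zero h
  ext x
  constructor
  · rintro ⟨v, rfl⟩
    rw [parabolaPoint, mem_parabola_iff h]
    field_simp
    ring
  · intro hx
    obtain ⟨a, b, rfl⟩ := mem_sectionPlane_iff.1 hx.1
    rw [mem_parabola_iff h] at hx
    refine ⟨b / 2 - inner ℝ (c.at u) (e.at u) / inner ℝ (e.at u) (e.at u), ?_⟩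
    simp only [parabolaPoint, sub_add_cancel]
    congr 2
    · field_simp
      linear_combination -hx
    · ring

theorem sectionPlane_orthogonal (h : axisDir c e u ≠ 0) {x : E3} :
    x ∈ (sectionPlane c e u)ᗮ ↔ ∃ l : ℝ, x = l • axisDir c e u := by
  constructor
  · intro hx
    rw [axisDir_eq] at h ⊢
    rw [Submodule.mem_orthogonal'] at hx
    exact eq_smul_cross h (hx _ (Submodule.subset_span (by simp)))
      (hx _ (Submodule.subset_span (by simp)))
  · rintro ⟨l, rfl⟩
    rw [Submodule.mem_orthogonal]
    intro y hy
    rw [real_inner_smul_right, inner_axisDir_of_mem hy, mul_zero]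

theorem setOf_parabolicCylinder (h : axisDir c e u ≠ 0) :
    {x | ∃ k l : ℝ, x = parabolaPoint c e u k + l • axisDir c e u} = parabolicCylinder c e u := by
  ext x
  simp only [parabolicCylinder, ← range_parabolaPoint h, sectionPlane_orthogonal h,
    Set.mem_ofPred_eq, Set.exists_range_iff, sub_eq_iff_eq_add']

/-- In orthogonal coordinates a = x·foot/|foot|², b = x·e/|e|², the equation of the parabola ignores
the axis component. Multiplying by |e|² removes the denominator of the foot-point, so only inner
products of x, c and e remain. -/
theorem mem_parabolicCylinder_iff (h : axisDir c e u ≠ 0) (x : E3) :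
    x ∈ parabolicCylinder c e u ↔ inner ℝ x (e.at u) ^ 2 =
      4 * (inner ℝ (c.at u) (c.at u) * inner ℝ (e.at u) (e.at u) - inner ℝ (c.at u) (e.at u) ^ 2
        - inner ℝ (e.at u) (e.at u) * inner ℝ x (c.at u)
        + inner ℝ (c.at u) (e.at u) * inner ℝ x (e.at u)) := by
  have hee := inner_dir_self_ne_zero h
  have hdd := inner_foot_self_ne_zero h
  have h1 : inner ℝ (e.at u) (e.at u) * inner ℝ (foot c e u) (foot c e u) =
      inner ℝ (c.at u) (c.at u) * inner ℝ (e.at u) (e.at u) - inner ℝ (c.at u) (e.at u) ^ 2 := by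
    rw [← inner_cross_self, ← axisDir_eq, axisDir, inner_cross_self, inner_foot_dir h]
    ring
  have h2 : inner ℝ (e.at u) (e.at u) * inner ℝ x (foot c e u) =
      inner ℝ (e.at u) (e.at u) * inner ℝ x (c.at u)
        - inner ℝ (c.at u) (e.at u) * inner ℝ x (e.at u) := by
    rw [foot, inner_sub_right, real_inner_smul_right]
    field_simp
  have h3 : x ∈ parabolicCylinder c e u ↔ inner ℝ x (e.at u) ^ 2 =
      4 * (inner ℝ (e.at u) (e.at u) * inner ℝ (foot c e u) (foot c e u)
        - inner ℝ (e.at u) (e.at u) * inner ℝ x (foot c e u)) := by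
    constructor
    · rintro ⟨y, hy, hxy⟩
      obtain ⟨a, b, rfl⟩ := mem_sectionPlane_iff.1 hy.1
      obtain ⟨l, hl⟩ := (sectionPlane_orthogonal h).1 hxy
      rw [mem_parabola_iff h] at hy
      have hx1 : inner ℝ x (e.at u) = b * inner ℝ (e.at u) (e.at u) := by
        rw [sub_eq_iff_eq_add.1 hl]
        simp only [inner_add_left, real_inner_smul_left, inner_foot_dir h,
          real_inner_comm (e.at u) (axisDir c e u),
          inner_axisDir_of_mem (dir_mem_sectionPlane c e u)]
        ring
      have hx2 : inner ℝ x (foot c e u) = a * inner ℝ (foot c e u) (foot c e u) := by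
        rw [sub_eq_iff_eq_add.1 hl]
        simp only [inner_add_left, real_inner_smul_left, real_inner_comm (foot c e u) (e.at u),
          inner_foot_dir h, real_inner_comm (foot c e u) (axisDir c e u),
          inner_axisDir_of_mem (foot_mem_sectionPlane c e u)]
        ring
      rw [hx1, hx2]
      linear_combination inner ℝ (e.at u) (e.at u) * hy
    · intro hx
      refine ⟨(inner ℝ x (foot c e u) / inner ℝ (foot c e u) (foot c e u)) • foot c e u +
        (inner ℝ x (e.at u) / inner ℝ (e.at u) (e.at u)) • e.at u, ?_, ?_⟩
      · rw [mem_parabola_iff h]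
        field_simp
        linear_combination hx
      · rw [sectionPlane_orthogonal h]
        apply eq_smul_cross h
        · simp only [inner_sub_left, inner_add_left, real_inner_smul_left,
            real_inner_comm (foot c e u) (e.at u), inner_foot_dir h]
          field_simp
          ring
        · simp only [inner_sub_left, inner_add_left, real_inner_smul_left, inner_foot_dir h]
          field_simp
          ring
  rw [h3, h1, h2, sub_sub_eq_add_sub]
  ring_nf

end ParabolaEquation

/-! ### Common denominators -/

/-- The product of all six denominators vanishes at the poles and nowhere else. -/
theorem exists_common_denominator (c e : RatCurve) :
    ∃ (q : Polynomial ℝ) (C E : Fin 3 → Polynomial ℝ), q ≠ 0 ∧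
      (∀ u, q.eval u ≠ 0 ↔ c.RegularAt u ∧ e.RegularAt u) ∧
      (∀ u i, q.eval u ≠ 0 → q.eval u * c.at u i = (C i).eval u) ∧
      (∀ u i, q.eval u ≠ 0 → q.eval u * e.at u i = (E i).eval u) := by
  have key (a b : RatCurve) (i : Fin 3) :
      (a i).denom ∣ (∏ i, (a i).denom) * ∏ i, (b i).denom :=
    Dvd.dvd.mul_right (Finset.dvd_prod_of_mem _ (Finset.mem_univ i)) _
  have reg (u : ℝ) : ((∏ i, (c i).denom) * ∏ i, (e i).denom).eval u ≠ 0 ↔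
      c.RegularAt u ∧ e.RegularAt u := by
    simp [Polynomial.eval_mul, Polynomial.eval_prod, Finset.prod_eq_zero_iff, RatCurve.RegularAt]
  choose C hC using fun i => key c e i
  choose E hE using fun i => mul_comm (∏ i, (c i).denom) (∏ i, (e i).denom) ▸ key e c i
  refine ⟨_, fun i => (c i).num * C i, fun i => (e i).num * E i, ?_, reg, ?_, ?_⟩
  · exact mul_ne_zero (Finset.prod_ne_zero_iff.2 fun i _ => (c i).denom_ne_zero)
      (Finset.prod_ne_zero_iff.2 fun i _ => (e i).denom_ne_zero)
  · intro u i hu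
    have := ((reg u).1 hu).1 i
    rw [hC i, RatCurve.at_apply, Polynomial.eval_mul, Polynomial.eval_mul]
    field_simp
  · intro u i hu
    have := ((reg u).1 hu).2 i
    rw [hE i, RatCurve.at_apply, Polynomial.eval_mul, Polynomial.eval_mul]
    field_simp

theorem exists_cylinder_polynomial (c e : RatCurve) : ∃ H : MvPolynomial (Fin 4) ℝ,
    ∀ u, c.RegularAt u → e.RegularAt u → axisDir c e u ≠ 0 →
      parabolicCylinder c e u = {x | MvPolynomial.eval ![u, x 0, x 1, x 2] H = 0} := by
  obtain ⟨q, C, E, -, hq, hC, hE⟩ := exists_common_denominator c e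
  let T : Polynomial ℝ → MvPolynomial (Fin 4) ℝ := fun p => Polynomial.aeval (MvPolynomial.X 0) p
  have hT (p : Polynomial ℝ) (u a b c : ℝ) :
      MvPolynomial.eval ![u, a, b, c] (T p) = p.eval u := by
    have := Polynomial.aeval_algHom_apply (MvPolynomial.aeval (R := ℝ) ![u, a, b, c])
      (MvPolynomial.X 0) p
    simpa [T, MvPolynomial.aeval_eq_eval] using this.symm
  let X' : Fin 3 → MvPolynomial (Fin 4) ℝ := 
    ![MvPolynomial.X 1, MvPolynomial.X 2, MvPolynomial.X 3]
  let dot : (Fin 3 → MvPolynomial (Fin 4) ℝ) → (Fin 3 → MvPolynomial (Fin 4) ℝ) →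
    MvPolynomial (Fin 4) ℝ := fun a b => a 0 * b 0 + a 1 * b 1 + a 2 * b 2
  let C' : Fin 3 → MvPolynomial (Fin 4) ℝ := fun i => T (C i)
  let E' : Fin 3 → MvPolynomial (Fin 4) ℝ := fun i => T (E i)
  -- The terms of the cylinder equation have degrees 2, 3 and 4 in (c, e); the powers of q bring all
  -- of them to q⁴ times the original.
  refine ⟨T q ^ 2 * dot X' E' ^ 2 - 4 * (dot C' C' * dot E' E' - dot C' E' ^ 2
    - T q * dot E' E' * dot X' C' + T q * dot C' E' * dot X' E'), ?_⟩
  intro u hc he hA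
  have hqu := (hq u).2 ⟨hc, he⟩
  ext x
  rw [mem_parabolicCylinder_iff hA, Set.mem_ofPred_eq]
  have h4 : MvPolynomial.eval ![u, x 0, x 1, x 2] (4 : MvPolynomial (Fin 4) ℝ) = 4 :=
    map_ofNat _ 4
  simp only [map_sub, map_add, map_mul, map_pow, h4, dot, X', C', E', hT, ← hC u _ hqu,
    ← hE u _ hqu, MvPolynomial.eval_X, inner_eq, Matrix.cons_val]
  rw [← sub_eq_zero, ← mul_right_inj' (pow_ne_zero 4 hqu), mul_zero]
  refine Eq.congr ?_ rfl
  ring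

/-! ### Rational functions of two variables -/

section Rational

theorem contDiff_eval_pair (P : MvPolynomial (Fin 2) ℝ) :
    ContDiff ℝ ∞ (fun p : ℝ × ℝ => MvPolynomial.eval ![p.1, p.2] P) := by
  induction P using MvPolynomial.induction_on with
  | C a => simpa using contDiff_const
  | add p q hp hq => simpa using hp.add hq
  | mul_X p i hp =>
    simp only [map_mul, MvPolynomial.eval_X]
    refine hp.mul ?_
    fin_cases i
    · exact contDiff_fst
    · exact contDiff_snd

theorem hasDerivAt_eval_fst (P : MvPolynomial (Fin 2) ℝ) (u t : ℝ) :
    HasDerivAt (fun u' => MvPolynomial.eval ![u', t] P)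
      (MvPolynomial.eval ![u, t] (MvPolynomial.pderiv 0 P)) u := by
  induction P using MvPolynomial.induction_on with
  | C a => simpa using hasDerivAt_const u a
  | add p q hp hq =>
    simp only [map_add]
    exact hp.add hq
  | mul_X p i hp =>
    simp only [map_mul, MvPolynomial.eval_X, Derivation.leibniz, MvPolynomial.pderiv_X,
      smul_eq_mul, map_add]
    fin_cases i
    · refine (hp.mul (hasDerivAt_id' u)).congr_deriv ?_
      simp
      ring
    · simpa [mul_comm] using hp.mul_const t

theorem hasDerivAt_eval_snd (P : MvPolynomial (Fin 2) ℝ) (u t : ℝ) :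
    HasDerivAt (fun t' => MvPolynomial.eval ![u, t'] P)
      (MvPolynomial.eval ![u, t] (MvPolynomial.pderiv 1 P)) t := by
  induction P using MvPolynomial.induction_on with
  | C a => simpa using hasDerivAt_const t a
  | add p q hp hq =>
    simp only [map_add]
    exact hp.add hq
  | mul_X p i hp =>
    simp only [map_mul, MvPolynomial.eval_X, Derivation.leibniz, MvPolynomial.pderiv_X,
      smul_eq_mul, map_add]
    fin_cases i
    · simpa [mul_comm] using hp.mul_const u
    · refine (hp.mul (hasDerivAt_id' t)).congr_deriv ?_
      simp
      ring

theorem isOpen_nonvanishing (Δ : MvPolynomial (Fin 2) ℝ) : IsOpen (nonvanishing Δ) :=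
  isOpen_ne_fun (contDiff_eval_pair Δ).continuous continuous_const

/-- A polynomial that vanishes on a product of two infinite sets, here neighbourhoods, is zero. -/
theorem dense_nonvanishing {Δ : MvPolynomial (Fin 2) ℝ} (h : Δ ≠ 0) :
    Dense (nonvanishing Δ) := by
  rintro ⟨u, t⟩
  by_contra hcon
  rw [mem_closure_iff_frequently, Filter.not_frequently, nhds_prod_eq,
    Filter.eventually_prod_iff] at hcon
  obtain ⟨pa, ha, pb, hb, hab⟩ := hcon
  apply h
  refine MvPolynomial.funext_set ![{x | pa x}, {x | pb x}] ?_ ?_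
  · intro i
    fin_cases i
    · exact infinite_of_mem_nhds u ha
    · exact infinite_of_mem_nhds t hb
  · intro x hx
    have h0 : pa (x 0) := hx 0 trivial
    have h1 : pb (x 1) := hx 1 trivial
    have h2 := hab h0 h1
    have h3 : ![x 0, x 1] = x := by ext i; fin_cases i <;> rfl
    simpa [nonvanishing, h3] using h2

variable {D : Set (ℝ × ℝ)} {a b : ℝ → ℝ → ℝ} {f g : ℝ → ℝ → E3}

namespace IsRationalOn

theorem mono (h : IsRationalOn a D) {D' : Set (ℝ × ℝ)} (hD : D' ⊆ D) : IsRationalOn a D' := by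
  obtain ⟨P, Q, hPQ⟩ := h
  exact ⟨P, Q, fun u t hp => hPQ u t (hD hp)⟩

theorem congr (h : IsRationalOn a D) (hab : ∀ u t, (u, t) ∈ D → b u t = a u t) :
    IsRationalOn b D := by
  obtain ⟨P, Q, hPQ⟩ := h
  exact ⟨P, Q, fun u t hp => ⟨(hPQ u t hp).1, (hab u t hp).trans (hPQ u t hp).2⟩⟩

theorem const (k : ℝ) : IsRationalOn (fun _ _ => k) D :=
  ⟨MvPolynomial.C k, 1, fun u t _ => by simp⟩

theorem snd : IsRationalOn (fun _ t => t) D := ⟨MvPolynomial.X 1, 1, fun u t _ => by simp⟩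

theorem polynomial (p : Polynomial ℝ) : IsRationalOn (fun u _ => p.eval u) D := by
  refine ⟨Polynomial.aeval (MvPolynomial.X 0) p, 1, fun u t _ => ⟨by simp, ?_⟩⟩
  have := Polynomial.aeval_algHom_apply (MvPolynomial.aeval (R := ℝ) ![u, t])
    (MvPolynomial.X 0) p
  simpa [MvPolynomial.aeval_eq_eval] using this

theorem add (ha : IsRationalOn a D) (hb : IsRationalOn b D) :
    IsRationalOn (fun u t => a u t + b u t) D := by
  obtain ⟨P, Q, h1⟩ := ha
  obtain ⟨P', Q', h2⟩ := hb
  refine ⟨P * Q' + Q * P', Q * Q', fun u t hp => ?_⟩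
  obtain ⟨h1, h1'⟩ := h1 u t hp
  obtain ⟨h2, h2'⟩ := h2 u t hp
  simp only [map_mul, map_add]
  exact ⟨mul_ne_zero h1 h2, by rw [h1', h2', div_add_div _ _ h1 h2]⟩

theorem mul (ha : IsRationalOn a D) (hb : IsRationalOn b D) :
    IsRationalOn (fun u t => a u t * b u t) D := by
  obtain ⟨P, Q, h1⟩ := ha
  obtain ⟨P', Q', h2⟩ := hb
  refine ⟨P * P', Q * Q', fun u t hp => ?_⟩
  obtain ⟨h1, h1'⟩ := h1 u t hp
  obtain ⟨h2, h2'⟩ := h2 u t hp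
  simp only [map_mul]
  exact ⟨mul_ne_zero h1 h2, by rw [h1', h2', div_mul_div_comm]⟩

theorem inv (ha : IsRationalOn a D) (h0 : ∀ u t, (u, t) ∈ D → a u t ≠ 0) :
    IsRationalOn (fun u t => (a u t)⁻¹) D := by
  obtain ⟨P, Q, h1⟩ := ha
  refine ⟨Q, P, fun u t hp => ?_⟩
  obtain ⟨h1, h1'⟩ := h1 u t hp
  have := h0 u t hp
  rw [h1'] at this
  exact ⟨fun h => this (by simp [h]), by simp only [h1', inv_div]⟩

theorem neg (ha : IsRationalOn a D) : IsRationalOn (fun u t => - a u t) D :=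
  ((const (-1)).mul ha).congr fun _ _ _ => by ring

theorem sub (ha : IsRationalOn a D) (hb : IsRationalOn b D) :
    IsRationalOn (fun u t => a u t - b u t) D :=
  (ha.add hb.neg).congr fun _ _ _ => by ring

theorem div (ha : IsRationalOn a D) (hb : IsRationalOn b D)
    (h0 : ∀ u t, (u, t) ∈ D → b u t ≠ 0) : IsRationalOn (fun u t => a u t / b u t) D :=
  (ha.mul (hb.inv h0)).congr fun _ _ _ => by rw [div_eq_mul_inv]

theorem pow (ha : IsRationalOn a D) (n : ℕ) : IsRationalOn (fun u t => a u t ^ n) D := by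
  induction n with
  | zero => simpa using const 1
  | succ n ih => simpa [pow_succ] using ih.mul ha

theorem contDiffAt (ha : IsRationalOn a D) (hD : IsOpen D) {u t : ℝ} (hp : (u, t) ∈ D) :
    ContDiffAt ℝ ∞ (fun p : ℝ × ℝ => a p.1 p.2) (u, t) := by
  obtain ⟨P, Q, h⟩ := ha
  refine ContDiffAt.congr_of_eventuallyEq (((contDiff_eval_pair P).contDiffAt).div
    ((contDiff_eval_pair Q).contDiffAt) (h u t hp).1) ?_
  filter_upwards [hD.mem_nhds hp] with p hp
  exact (h p.1 p.2 hp).2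

theorem contDiffOn (ha : IsRationalOn a D) (hD : IsOpen D) :
    ContDiffOn ℝ ∞ (fun p : ℝ × ℝ => a p.1 p.2) D :=
  fun _ hp => (ha.contDiffAt hD hp).contDiffWithinAt

theorem dFst (ha : IsRationalOn a D) (hD : IsOpen D) : IsRationalOn (dFst a) D := by
  obtain ⟨P, Q, h⟩ := ha
  refine ⟨MvPolynomial.pderiv 0 P * Q - P * MvPolynomial.pderiv 0 Q, Q ^ 2, fun u t hp => ?_⟩
  have hQ := (h u t hp).1
  simp only [map_sub, map_mul, map_pow]
  refine ⟨pow_ne_zero 2 hQ, ?_⟩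
  rw [dFst_congr hD hp (fun u t hp => (h u t hp).2)]
  exact ((hasDerivAt_eval_fst P u t).div (hasDerivAt_eval_fst Q u t) hQ).deriv

theorem dSnd (ha : IsRationalOn a D) (hD : IsOpen D) : IsRationalOn (dSnd a) D := by
  obtain ⟨P, Q, h⟩ := ha
  refine ⟨MvPolynomial.pderiv 1 P * Q - P * MvPolynomial.pderiv 1 Q, Q ^ 2, fun u t hp => ?_⟩
  have hQ := (h u t hp).1
  simp only [map_sub, map_mul, map_pow]
  refine ⟨pow_ne_zero 2 hQ, ?_⟩
  rw [dSnd_congr hD hp (fun u t hp => (h u t hp).2)]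
  exact ((hasDerivAt_eval_snd P u t).div (hasDerivAt_eval_snd Q u t) hQ).deriv

/-- A rational function that is not identically zero is nonzero on a Zariski-open set. -/
theorem exists_nonvanishing {Δ : MvPolynomial (Fin 2) ℝ} (ha : IsRationalOn a (nonvanishing Δ))
    (hne : ∃ u t, (u, t) ∈ nonvanishing Δ ∧ a u t ≠ 0) :
    ∃ Δ' : MvPolynomial (Fin 2) ℝ, Δ' ≠ 0 ∧
      ∀ u t, (u, t) ∈ nonvanishing Δ' ↔ (u, t) ∈ nonvanishing Δ ∧ a u t ≠ 0 := by
  obtain ⟨P, Q, h⟩ := ha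
  have key : ∀ u t, (u, t) ∈ nonvanishing (Δ * P) ↔ (u, t) ∈ nonvanishing Δ ∧ a u t ≠ 0 := by
    intro u t
    have h1 : (u, t) ∈ nonvanishing (Δ * P) ↔
        (u, t) ∈ nonvanishing Δ ∧ MvPolynomial.eval ![u, t] P ≠ 0 := by
      simp [nonvanishing]
    rw [h1]
    refine and_congr_right fun hp => ?_
    rw [(h u t hp).2, div_ne_zero_iff, and_iff_left (h u t hp).1]
  refine ⟨Δ * P, ?_, key⟩
  obtain ⟨u, t, hut⟩ := hne
  intro h0
  have := (key u t).2 hut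
  simp [h0, nonvanishing] at this

theorem smul (ha : IsRationalOn a D) (hf : IsRationalMapOn f D) :
    IsRationalMapOn (fun u t => a u t • f u t) D := fun i => ha.mul (hf i)

end IsRationalOn

namespace IsRationalMapOn

theorem mono (h : IsRationalMapOn f D) {D' : Set (ℝ × ℝ)} (hD : D' ⊆ D) :
    IsRationalMapOn f D' := fun i => (h i).mono hD

theorem add (hf : IsRationalMapOn f D) (hg : IsRationalMapOn g D) :
    IsRationalMapOn (fun u t => f u t + g u t) D := fun i => (hf i).add (hg i)

theorem sub (hf : IsRationalMapOn f D) (hg : IsRationalMapOn g D) :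
    IsRationalMapOn (fun u t => f u t - g u t) D := fun i => (hf i).sub (hg i)

theorem inner (hf : IsRationalMapOn f D) (hg : IsRationalMapOn g D) :
    IsRationalOn (fun u t => inner ℝ (f u t) (g u t)) D :=
  ((((hf 0).mul (hg 0)).add ((hf 1).mul (hg 1))).add ((hf 2).mul (hg 2))).congr
    fun _ _ _ => inner_eq _ _

theorem cross (hf : IsRationalMapOn f D) (hg : IsRationalMapOn g D) :
    IsRationalMapOn (fun u t => cross (f u t) (g u t)) D := by
  intro i
  fin_cases i
  · exact (((hf 1).mul (hg 2)).sub ((hf 2).mul (hg 1))).congr fun _ _ _ => cross_zero _ _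
  · exact (((hf 2).mul (hg 0)).sub ((hf 0).mul (hg 2))).congr fun _ _ _ => cross_one _ _
  · exact (((hf 0).mul (hg 1)).sub ((hf 1).mul (hg 0))).congr fun _ _ _ => cross_two _ _

theorem contDiffAt (hf : IsRationalMapOn f D) (hD : IsOpen D) {u t : ℝ} (hp : (u, t) ∈ D) :
    ContDiffAt ℝ ∞ (fun p : ℝ × ℝ => f p.1 p.2) (u, t) := by
  rw [contDiffAt_euclidean]
  exact fun i => (hf i).contDiffAt hD hp

theorem contDiffOn (hf : IsRationalMapOn f D) (hD : IsOpen D) :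
    ContDiffOn ℝ ∞ (fun p : ℝ × ℝ => f p.1 p.2) D :=
  fun _ hp => (hf.contDiffAt hD hp).contDiffWithinAt

theorem dFst (hf : IsRationalMapOn f D) (hD : IsOpen D) : IsRationalMapOn (dFst f) D := by
  intro i
  refine ((hf i).dFst hD).congr fun u t hp => ?_
  have h1 := hasDerivAt_dFst ((hf.contDiffAt hD hp).differentiableAt (by simp))
  exact ((EuclideanSpace.proj (𝕜 := ℝ) i).hasFDerivAt.comp_hasDerivAt u h1).deriv.symm

theorem dSnd (hf : IsRationalMapOn f D) (hD : IsOpen D) : IsRationalMapOn (dSnd f) D := by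
  intro i
  refine ((hf i).dSnd hD).congr fun u t hp => ?_
  have h1 := hasDerivAt_dSnd ((hf.contDiffAt hD hp).differentiableAt (by simp))
  exact ((EuclideanSpace.proj (𝕜 := ℝ) i).hasFDerivAt.comp_hasDerivAt t h1).deriv.symm

theorem ratCurve (c : RatCurve) (hc : ∀ u t, (u, t) ∈ D → c.RegularAt u) :
    IsRationalMapOn (fun u _ => c.at u) D := fun i =>
  (IsRationalOn.polynomial (c i).num).div (IsRationalOn.polynomial (c i).denom)
    fun u t hp => hc u t hp i

theorem deriv_ratCurve (c : RatCurve) (hD : IsOpen D) (hc : ∀ u t, (u, t) ∈ D → c.RegularAt u) :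
    IsRationalMapOn (fun u _ => deriv c.at u) D := (ratCurve c hc).dFst hD

end IsRationalMapOn

end Rational

/-! ### Nonnegative polynomials and rational unit vectors -/

section SumOfTwoSquares

open Polynomial

/-- A negative value of p persists on an open set, where q would have to vanish; but q has finitely
many roots. -/
theorem nonneg_of_mul_nonneg {p q : ℝ[X]} (hq : q ≠ 0) (hq0 : ∀ x, 0 ≤ q.eval x)
    (h : ∀ x, 0 ≤ (q * p).eval x) (x : ℝ) : 0 ≤ p.eval x := by
  by_contra! hx
  have h1 : ∀ᶠ y in nhds x, p.eval y < 0 :=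
    (p.continuous.continuousAt).eventually_lt continuousAt_const hx
  have h2 : {y | p.eval y < 0} ⊆ {y | q.IsRoot y} := by
    intro y hy
    have h3 := h y
    rw [eval_mul] at h3
    have hy' : p.eval y < 0 := hy
    have : q.eval y ≤ 0 := by nlinarith [hq0 y]
    exact le_antisymm this (hq0 y)
  exact infinite_of_mem_nhds x h1 ((finite_setOfPred_isRoot hq).subset h2)

/-- A nonnegative real polynomial in one variable is a sum of two squares. -/
theorem exists_sum_two_squares (p : ℝ[X]) (hp : ∀ x, 0 ≤ p.eval x) :
    ∃ a b : ℝ[X], p = a ^ 2 + b ^ 2 := by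
  induction hn : p.natDegree using Nat.strong_induction_on generalizing p with
  | _ n ih =>
    by_cases hp0 : p = 0
    · exact ⟨0, 0, by simp [hp0]⟩
    by_cases hdeg : p.degree = 0
    · rw [eq_C_of_degree_eq_zero hdeg] at hp ⊢
      refine ⟨C (Real.sqrt (p.coeff 0)), 0, ?_⟩
      have := hp 0
      rw [eval_C] at this
      rw [← C_pow, Real.sq_sqrt this]
      simp
    obtain ⟨z, hz⟩ := IsAlgClosed.exists_aeval_eq_zero ℂ p hdeg
    -- Split off a quadratic factor that is itself a sum of two squares: (X - z)² for a real root,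
    -- (X - Re z)² + (Im z)² for a nonreal one.
    obtain ⟨q, hq, hqe, hdvd⟩ : ∃ q : ℝ[X], (∃ a b : ℝ[X], q = a ^ 2 + b ^ 2) ∧
        q.natDegree = 2 ∧ q ∣ p := by
      by_cases him : z.im = 0
      · have hroot : p.eval z.re = 0 := by
          have hz' : z = (z.re : ℂ) := Complex.ext (by simp) (by simp [him])
          rw [hz'] at hz
          have h1 := aeval_algebraMap_apply ℂ z.re p
          rw [show (algebraMap ℝ ℂ z.re) = (z.re : ℂ) from rfl, hz] at h1
          simpa using h1.symm
        refine ⟨(X - C z.re) ^ 2, ⟨X - C z.re, 0, by ring⟩, by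
          rw [natDegree_pow, natDegree_X_sub_C], ?_⟩
        obtain ⟨w, hw⟩ := dvd_iff_isRoot.2 hroot
        -- A real root is a minimum of the nonnegative polynomial, hence at least a double root.
        have hwr : w.eval z.re = 0 := by
          have hder : HasDerivAt (fun x => p.eval x) (p.derivative.eval z.re) z.re :=
            p.hasDerivAt z.re
          have hmin : IsLocalMin (fun x => p.eval x) z.re :=
            .of_forall fun x => by simpa [hroot] using hp x
          have h1 := hmin.hasDerivAt_eq_zero hder
          rw [hw] at h1
          simpa using h1
        obtain ⟨w', hw'⟩ := dvd_iff_isRoot.2 hwr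
        exact ⟨w', by rw [hw, hw']; ring⟩
      · refine ⟨X ^ 2 - C (2 * z.re) * X + C (‖z‖ ^ 2), ⟨X - C z.re, C z.im, ?_⟩, ?_,
          quadratic_dvd_of_aeval_eq_zero_im_ne_zero p hz him⟩
        · rw [← Complex.normSq_eq_norm_sq, Complex.normSq_apply]
          simp only [map_add, map_mul, map_ofNat]
          ring
        · have : X ^ 2 - C (2 * z.re) * X + C (‖z‖ ^ 2) =
              C 1 * X ^ 2 + C (-(2 * z.re)) * X + C (‖z‖ ^ 2) := by
            simp only [map_neg, map_one]; ring
          rw [this, natDegree_quadratic one_ne_zero]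
    obtain ⟨w, hw⟩ := hdvd
    have hq0 : q ≠ 0 := by rintro rfl; simp at hqe
    have hw0 : w ≠ 0 := by rintro rfl; simp [hw] at hp0
    have hqn : ∀ x, 0 ≤ q.eval x := by
      obtain ⟨a, b, rfl⟩ := hq
      intro x
      rw [eval_add, eval_pow, eval_pow]
      positivity
    obtain ⟨a', b', hab'⟩ := ih w.natDegree (by
      rw [← hn, hw, natDegree_mul hq0 hw0, hqe]; lia) w
      (nonneg_of_mul_nonneg hq0 hqn (hw ▸ hp)) rfl
    obtain ⟨a, b, hab⟩ := hq
    -- The product formula for sums of two squares, as for norms of complex numbers.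
    refine ⟨a * a' - b * b', a * b' + b * a', ?_⟩
    rw [hw, hab, hab']
    ring

/-- In every plane through `O` over the field of rational functions there is a vector whose
length is rational. -/
theorem exists_rational_length (N : Fin 3 → ℝ[X]) : ∃ (S : Fin 3 → ℝ[X]) (h : ℝ[X]), h ≠ 0 ∧
    S 0 * N 0 + S 1 * N 1 + S 2 * N 2 = 0 ∧ S 0 ^ 2 + S 1 ^ 2 + S 2 ^ 2 = h ^ 2 := by
  by_cases hN : N 2 = 0
  · exact ⟨![0, 0, 1], 1, one_ne_zero, by simp [hN], by simp⟩
  obtain ⟨p, q, hpq⟩ := exists_sum_two_squares (N 0 ^ 2 + N 1 ^ 2 + N 2 ^ 2) (fun x => by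
    simp only [eval_add, eval_pow]; positivity)
  -- The vectors N and (p, q, 0) have the same length, so the reflection in the plane orthogonal to
  -- w = (p, q, 0) - N exchanges them. It maps (0, 0, 1), which is orthogonal to (p, q, 0), to a
  -- unit vector orthogonal to N; multiplying by |w|² clears the denominator.
  refine ⟨![2 * (p - N 0) * N 2, 2 * (q - N 1) * N 2,
    (p - N 0) ^ 2 + (q - N 1) ^ 2 - N 2 ^ 2], (p - N 0) ^ 2 + (q - N 1) ^ 2 + N 2 ^ 2, ?_, ?_, ?_⟩
  · intro h0
    apply hN
    apply Polynomial.funext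
    intro x
    have := congrArg (eval x) h0
    simp only [eval_add, eval_pow, eval_zero] at this ⊢
    have h2 : eval x (N 2) ^ 2 = 0 := by
      nlinarith [sq_nonneg (eval x (p - N 0)), sq_nonneg (eval x (q - N 1)),
        sq_nonneg (eval x (N 2))]
    simpa using h2
  · simp only [Matrix.cons_val]
    linear_combination (-N 2) * hpq
  · simp only [Matrix.cons_val]
    ring

end SumOfTwoSquares

/-! ### The envelope of the planes is not a curve -/

section Algebra

open Polynomial

/-- In the application G = |c + v e|², D = a + v b is the determinant of g, g_u, e, and P = |g_u ×
e|². The identity 4D²P + G(DQ - Gδ²) = 0 makes G divide D²P; being irreducible and of higher degree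
than D, it divides P, and equal degree bounds leave a constant factor κ. -/
theorem quadratic_relation {cc ce ee p0 p1 p2 a b δ q0 q1 q2 : ℝ} (hK : 0 < cc * ee - ce ^ 2)
    (hab : a ≠ 0 ∨ b ≠ 0)
    (H : ∀ v, a + v * b ≠ 0 → 4 * (a + v * b) ^ 2 * (p0 + 2 * v * p1 + v ^ 2 * p2) +
      (cc + 2 * v * ce + v ^ 2 * ee) * ((a + v * b) * (q0 + v * q1 + v ^ 2 * q2) -
        (cc + 2 * v * ce + v ^ 2 * ee) * δ ^ 2) = 0) :
    ∃ κ : ℝ, p0 = κ * cc ∧ p1 = κ * ce ∧ p2 = κ * ee ∧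
      ∀ v, (a + v * b) * (4 * κ * (a + v * b) + (q0 + v * q1 + v ^ 2 * q2)) =
        (cc + 2 * v * ce + v ^ 2 * ee) * δ ^ 2 := by
  have hee : ee ≠ 0 := by rintro rfl; nlinarith [sq_nonneg ce]
  set G : ℝ[X] := C ee * X ^ 2 + C (2 * ce) * X + C cc with hG
  set D : ℝ[X] := C b * X + C a with hD
  set P : ℝ[X] := C p2 * X ^ 2 + C (2 * p1) * X + C p0 with hP
  set Q : ℝ[X] := C q2 * X ^ 2 + C q1 * X + C q0 with hQ
  have hGdeg : G.natDegree = 2 := natDegree_quadratic hee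
  have hG0 : G ≠ 0 := by intro h; simp [h] at hGdeg
  have hGe (v : ℝ) : G.eval v = cc + 2 * v * ce + v ^ 2 * ee := by simp [hG]; ring
  have hDe (v : ℝ) : D.eval v = a + v * b := by simp [hD]; ring
  have hPe (v : ℝ) : P.eval v = p0 + 2 * v * p1 + v ^ 2 * p2 := by simp [hP]; ring
  have hQe (v : ℝ) : Q.eval v = q0 + v * q1 + v ^ 2 * q2 := by simp [hQ]; ring
  -- The discriminant is negative: `hK` excludes a real root.
  have hGirr : Irreducible G := by
    refine irreducible_of_degree_le_three_of_not_isRoot (by rw [hGdeg]; decide) fun x hx => ?_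
    have hx : G.eval x = 0 := hx
    rw [hGe] at hx
    nlinarith [sq_nonneg (ee * x + ce), congrArg (ee * ·) hx]
  have hD0 : D ≠ 0 := by
    intro h
    have h0 := hDe 0
    have h1 := hDe 1
    rw [h] at h0 h1
    simp at h0 h1
    rcases hab with h2 | h2
    · exact h2 h0.symm
    · exact h2 (by linarith)
  have hGD : ¬ G ∣ D := fun h => by
    have h1 := natDegree_le_of_dvd h hD0
    have h2 : D.natDegree ≤ 1 := natDegree_linear_le
    lia
  -- The extra factor D makes the identity hold also at the excluded root of D; it is cancelled
  -- afterwards.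
  have hpoly : D * (4 * D ^ 2 * P + G * (D * Q - G * C (δ ^ 2))) = 0 := by
    apply Polynomial.funext
    intro v
    simp only [eval_mul, eval_add, eval_sub, eval_pow, eval_C, eval_ofNat, hGe, hDe, hPe, hQe,
      eval_zero]
    by_cases h : a + v * b = 0
    · rw [h, zero_mul]
    · rw [H v h, mul_zero]
  have hpoly := (mul_eq_zero.1 hpoly).resolve_left hD0
  have hdvd : G ∣ C 4 * (D ^ 2 * P) := ⟨-(D * Q - G * C (δ ^ 2)), by
    rw [show (C 4 : ℝ[X]) = 4 from rfl]; linear_combination hpoly⟩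
  rw [(isUnit_C.2 (isUnit_iff_ne_zero.2 four_ne_zero)).dvd_mul_left] at hdvd
  obtain ⟨k, hk⟩ : G ∣ P :=
    (hGirr.prime.dvd_or_dvd hdvd).resolve_left fun h => hGD (hGirr.prime.dvd_of_dvd_pow h)
  obtain ⟨κ, rfl⟩ : ∃ κ, k = C κ := by
    by_cases hk0 : k = 0
    · exact ⟨0, by simp [hk0]⟩
    · have h1 := natDegree_mul hG0 hk0
      have h2 : P.natDegree ≤ 2 := natDegree_quadratic_le
      rw [← hk, hGdeg] at h1
      exact ⟨_, eq_C_of_natDegree_eq_zero (by lia)⟩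
  have hPG (v : ℝ) : p0 + 2 * v * p1 + v ^ 2 * p2 = (cc + 2 * v * ce + v ^ 2 * ee) * κ := by
    rw [← hPe, hk, eval_mul, eval_C, hGe]
  refine ⟨κ, ?_, ?_, ?_, fun v => ?_⟩
  · linear_combination hPG 0
  -- The coefficients are recovered from the values at 0, 1 and -1.
  · linear_combination hPG 1 / 4 - hPG (-1) / 4
  · linear_combination hPG 1 / 2 + hPG (-1) / 2 - hPG 0
  · have h1 : G * (D * (4 * C κ * D + Q) - G * C (δ ^ 2)) = 0 := by
      rw [hk] at hpoly; linear_combination hpoly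
    have h2 := congrArg (eval v) ((mul_eq_zero.1 h1).resolve_left hG0)
    simp only [eval_mul, eval_add, eval_sub, eval_C, eval_ofNat, hGe, hDe, hQe, eval_zero] at h2
    linear_combination h2

/-- If the second fundamental form of the envelope degenerates along a ruling, then so does the
distribution of the tangent planes, and the derivatives of the ruling satisfy a relation. -/
theorem ruling_relation {c c₁ c₂ e e₁ e₂ : E3} (hce : cross c e ≠ 0)
    (hab : inner ℝ c (cross c₁ e) ≠ 0 ∨ inner ℝ c (cross e₁ e) ≠ 0)
    (H : ∀ v : ℝ, inner ℝ (c + v • e) (cross (c₁ + v • e₁) e) ≠ 0 →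
      (2 * inner ℝ (c₁ + v • e₁) (c₁ + v • e₁) +
        inner ℝ (c + v • e) (c + v • e) / inner ℝ (c + v • e) (cross (c₁ + v • e₁) e) *
          inner ℝ (cross (c₁ + v • e₁) e) (c₂ + v • e₂)) * (2 * inner ℝ e e) =
      (2 * inner ℝ (c₁ + v • e₁) e +
        inner ℝ (c + v • e) (c + v • e) / inner ℝ (c + v • e) (cross (c₁ + v • e₁) e) *
          inner ℝ (cross (c₁ + v • e₁) e) e₁) ^ 2) :
    inner ℝ c (cross e₁ e) = 0 ∧ inner ℝ (cross c₁ e) e₁ ≠ 0 ∧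
      2 * inner ℝ c (cross c₁ e) * inner ℝ (cross e₁ e) e₂ = inner ℝ (cross c₁ e) e₁ ^ 2 := by
  have hK : 0 < inner ℝ c c * inner ℝ e e - inner ℝ c e ^ 2 := by
    rw [← inner_cross_self]
    exact real_inner_self_pos.2 hce
  have hee : inner ℝ e e ≠ 0 := by
    intro h0
    rw [h0] at hK
    nlinarith [sq_nonneg (inner ℝ c e)]
  have hcross (v : ℝ) : cross (c₁ + v • e₁) e = cross c₁ e + v • cross e₁ e := by
    apply ext3 <;> simp only [cross_zero, cross_one, cross_two, PiLp.add_apply, PiLp.smul_apply,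
      smul_eq_mul] <;> ring
  have hdet (v : ℝ) : inner ℝ (c + v • e) (cross (c₁ + v • e₁) e) =
      inner ℝ c (cross c₁ e) + v * inner ℝ c (cross e₁ e) := by
    rw [hcross]
    simp only [inner_add_left, inner_add_right, real_inner_smul_left, real_inner_smul_right,
      inner_right_cross]
    ring
  have hδ (v : ℝ) : inner ℝ (cross (c₁ + v • e₁) e) e₁ = inner ℝ (cross c₁ e) e₁ := by
    rw [hcross, inner_add_left, real_inner_smul_left, real_inner_comm e₁ (cross e₁ e),
      inner_left_cross]
    ring
  have hgg (v : ℝ) : inner ℝ (c + v • e) (c + v • e) =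
      inner ℝ c c + 2 * v * inner ℝ c e + v ^ 2 * inner ℝ e e := by
    simp only [inner_add_left, inner_add_right, real_inner_smul_left, real_inner_smul_right,
      real_inner_comm c e]
    ring
  have hmm (v : ℝ) : inner ℝ (c₁ + v • e₁) (c₁ + v • e₁) * inner ℝ e e -
      inner ℝ (c₁ + v • e₁) e ^ 2 = inner ℝ (cross c₁ e) (cross c₁ e) +
        2 * v * inner ℝ (cross c₁ e) (cross e₁ e) + v ^ 2 * inner ℝ (cross e₁ e) (cross e₁ e) := by
    rw [← inner_cross_self, hcross]
    simp only [inner_add_left, inner_add_right, real_inner_smul_left, real_inner_smul_right,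
      real_inner_comm (cross c₁ e) (cross e₁ e)]
    ring
  -- Multiplying `H` by the squared determinant and using |g_u|²|e|² - (g_u·e)² = |g_u × e|² gives a
  -- polynomial identity in v with these coefficients.
  obtain ⟨κ, h0, h1, h2, hv⟩ := quadratic_relation
    (p0 := inner ℝ (cross c₁ e) (cross c₁ e)) (p1 := inner ℝ (cross c₁ e) (cross e₁ e))
    (p2 := inner ℝ (cross e₁ e) (cross e₁ e)) (δ := inner ℝ (cross c₁ e) e₁)
    (q0 := 2 * inner ℝ e e * inner ℝ (cross c₁ e) c₂ - 4 * inner ℝ c₁ e * inner ℝ (cross c₁ e) e₁)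
    (q1 := 2 * inner ℝ e e * (inner ℝ (cross c₁ e) e₂ + inner ℝ (cross e₁ e) c₂) -
      4 * inner ℝ e₁ e * inner ℝ (cross c₁ e) e₁)
    (q2 := 2 * inner ℝ e e * inner ℝ (cross e₁ e) e₂) hK hab (fun v hne => by
      have h := H v (by rwa [hdet])
      rw [hδ, hdet, ← hgg] at *
      rw [← hmm v]
      have hexp : inner ℝ (cross (c₁ + v • e₁) e) (c₂ + v • e₂) = inner ℝ (cross c₁ e) c₂ +
          v * (inner ℝ (cross c₁ e) e₂ + inner ℝ (cross e₁ e) c₂) +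
            v ^ 2 * inner ℝ (cross e₁ e) e₂ := by
        rw [hcross]
        simp only [inner_add_left, inner_add_right, real_inner_smul_left, real_inner_smul_right]
        ring
      have hlin : inner ℝ (c₁ + v • e₁) e = inner ℝ c₁ e + v * inner ℝ e₁ e := by
        rw [inner_add_left, real_inner_smul_left]
      rw [hexp] at h
      rw [hlin] at h ⊢
      field_simp at h
      linear_combination h)
  -- If δ = 0, then c₁ × e and e₁ × e have Gram determinant δ²|e|² = 0. But this determinant is κ²|c
  -- × e|², so κ = 0, both vectors vanish, and so does the determinant of g, g_u, e.
  have hδ0 : inner ℝ (cross c₁ e) e₁ ≠ 0 := by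
    intro h3
    have h4 : inner ℝ (cross c₁ e) (cross c₁ e) * inner ℝ (cross e₁ e) (cross e₁ e) -
        inner ℝ (cross c₁ e) (cross e₁ e) ^ 2 = inner ℝ (cross c₁ e) e₁ ^ 2 * inner ℝ e e := by
      simp only [inner_eq, cross_zero, cross_one, cross_two]
      ring
    rw [h3, h0, h1, h2] at h4
    have h5 : κ ^ 2 * (inner ℝ c c * inner ℝ e e - inner ℝ c e ^ 2) = 0 := by
      linear_combination h4
    have h6 : κ = 0 := by simpa using (mul_eq_zero.1 h5).resolve_right hK.ne'
    rw [h6, zero_mul] at h0 h2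
    rw [eq_zero_of_inner_self h0, eq_zero_of_inner_self h2] at hab
    simp at hab
  -- Otherwise the linear determinant has a real root in v, and there |g|² δ² = 0, although the
  -- ruling misses O.
  have hb : inner ℝ c (cross e₁ e) = 0 := by
    by_contra hb
    have h3 := hv (-(inner ℝ c (cross c₁ e) / inner ℝ c (cross e₁ e)))
    have h4 : inner ℝ c (cross c₁ e) +
        -(inner ℝ c (cross c₁ e) / inner ℝ c (cross e₁ e)) * inner ℝ c (cross e₁ e) = 0 := by
      field_simp
      ring
    rw [h4, zero_mul, ← hgg, eq_comm, mul_eq_zero] at h3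
    rcases h3 with h3 | h3
    · have h5 := eq_zero_of_inner_self h3
      apply hce
      rw [add_eq_zero_iff_eq_neg] at h5
      rw [h5]
      apply ext3 <;> simp <;> ring
    · exact hδ0 (by simpa using h3)
  refine ⟨hb, hδ0, mul_left_cancel₀ hee ?_⟩
  rw [hb] at hv
  -- Comparison of the coefficients of v².
  linear_combination hv 1 / 2 + hv (-1) / 2 - hv 0

end Algebra

/-- With δ = (c₁ × e)·e₁, the hypothesis `hb'`, the derivative of `hb`, says c·(e₂ × e) = δ. The
Plücker relation `h2` then makes the product in `h` equal to -δ², so that -2δ² = δ². -/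
theorem deriv_relation_false {c c₁ e e₁ e₂ : E3} (hδ : inner ℝ (cross c₁ e) e₁ ≠ 0)
    (hb : inner ℝ c (cross e₁ e) = 0)
    (hb' : inner ℝ c₁ (cross e₁ e) + inner ℝ c (cross e₂ e) = 0)
    (h : 2 * inner ℝ c (cross c₁ e) * inner ℝ (cross e₁ e) e₂ = inner ℝ (cross c₁ e) e₁ ^ 2) :
    False := by
  have h1 : inner ℝ c₁ (cross e₁ e) = -inner ℝ (cross c₁ e) e₁ := by
    simp only [inner_eq, cross_zero, cross_one, cross_two]
    ring
  have h2 : inner ℝ c (cross c₁ e) * inner ℝ (cross e₁ e) e₂ =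
      inner ℝ c (cross e₂ e) * inner ℝ c₁ (cross e₁ e) -
        inner ℝ c (cross e₁ e) * inner ℝ c₁ (cross e₂ e) := by
    simp only [inner_eq, cross_zero, cross_one, cross_two]
    ring
  apply hδ
  have h3 : 3 * inner ℝ (cross c₁ e) e₁ ^ 2 = 0 := by
    rw [hb, h1] at h2
    rw [h1] at hb'
    linear_combination (-1) * h + 2 * h2 - 2 * inner ℝ (cross c₁ e) e₁ * hb'
  simpa using h3

/-! ### The differential of the envelope -/

namespace IsPolarRep

variable {c e : RatCurve} {U : Set (ℝ × ℝ)} {v r : ℝ → ℝ → ℝ} {s : ℝ → ℝ → E3} {u t : ℝ}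
  (h : IsPolarRep c e U v r s) (hp : (u, t) ∈ U)

include h hp

theorem pedalPt_fst : HasDerivAt (fun u' => pedalPt c e u' (v u' t))
    (dFst (fun u t => pedalPt c e u (v u t)) u t) u :=
  hasDerivAt_dFst (f := fun u t => pedalPt c e u (v u t))
    ((h.contDiffAt_pedalPt hp).differentiableAt (by simp))

theorem pedalPt_snd : HasDerivAt (fun t' => pedalPt c e u (v u t'))
    (dSnd (fun u t => pedalPt c e u (v u t)) u t) t :=
  hasDerivAt_dSnd (f := fun u t => pedalPt c e u (v u t))
    ((h.contDiffAt_pedalPt hp).differentiableAt (by simp))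

theorem ruledVel_fst : HasDerivAt (fun u' => ruledVel c e u' (v u' t))
    (deriv (deriv c.at) u + v u t • deriv (deriv e.at) u + dFst v u t • deriv e.at u) u := by
  have hd {c : RatCurve} (hc : c.RegularAt u) :
      HasDerivAt (deriv c.at) (deriv (deriv c.at) u) u :=
    ((RatCurve.contDiffAt_deriv hc).differentiableAt (by simp)).hasDerivAt
  have := (hd (h.regular_c hp)).add ((h.v_fst hp).smul (hd (h.regular_e hp)))
  rw [← add_assoc] at this
  exact this

theorem ruledVel_snd : HasDerivAt (fun t' => ruledVel c e u (v u t'))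
    (dSnd v u t • deriv e.at u) t :=
  ((h.v_snd hp).smul_const (deriv e.at u)).const_add (deriv c.at u)

/-- Where the envelope is not immersed its second fundamental form, expressed by the ruled
surface, is degenerate. -/
theorem degenerate_of_cross_eq_zero
    (hJ : cross (dFst (fun u t => pedalPt c e u (v u t)) u t)
      (dSnd (fun u t => pedalPt c e u (v u t)) u t) = 0) :
    (2 * inner ℝ (ruledVel c e u (v u t)) (ruledVel c e u (v u t)) +
      inner ℝ (ruled c e u (v u t)) (ruled c e u (v u t)) / ruledDet c e u (v u t) *
        inner ℝ (cross (ruledVel c e u (v u t)) (e.at u))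
          (deriv (deriv c.at) u + v u t • deriv (deriv e.at) u)) *
        (2 * inner ℝ (e.at u) (e.at u)) =
    (2 * inner ℝ (ruledVel c e u (v u t)) (e.at u) +
      inner ℝ (ruled c e u (v u t)) (ruled c e u (v u t)) / ruledDet c e u (v u t) *
        inner ℝ (cross (ruledVel c e u (v u t)) (e.at u)) (deriv e.at u)) ^ 2 := by
  have hE := RatCurve.hasDerivAt (h.regular_e hp)
  -- Differentiate f·e = 2g·e and f·g_u = 2g·g_u in both parameters; this expresses the inner
  -- products of f_u and f_t with g_u and e by the ruled surface.
  have e1 := hasDerivAt_unique_of_eventuallyEq ((h.pedalPt_fst hp).inner ℝ hE)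
    (((h.ruled_fst hp).inner ℝ hE).const_mul 2) (.of_forall fun _ => inner_pedalPt_dir)
  have e2 := hasDerivAt_unique_of_eventuallyEq
    ((h.pedalPt_snd hp).inner ℝ (hasDerivAt_const t (e.at u)))
    (((h.ruled_snd hp).inner ℝ (hasDerivAt_const t (e.at u))).const_mul 2)
    (.of_forall fun _ => inner_pedalPt_dir)
  have e3 := hasDerivAt_unique_of_eventuallyEq ((h.pedalPt_fst hp).inner ℝ (h.ruledVel_fst hp))
    (((h.ruled_fst hp).inner ℝ (h.ruledVel_fst hp)).const_mul 2)
    (.of_forall fun _ => inner_pedalPt_ruledVel)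
  have e4 := hasDerivAt_unique_of_eventuallyEq ((h.pedalPt_snd hp).inner ℝ (h.ruledVel_snd hp))
    (((h.ruled_snd hp).inner ℝ (h.ruledVel_snd hp)).const_mul 2)
    (.of_forall fun _ => inner_pedalPt_ruledVel)
  -- (f_u × f_t)·(g_u × e) is the determinant of these four products. The v_u terms cancel, and what
  -- is left is v_t times the discriminant of the form.
  have e5 := inner_cross_cross (dFst (fun u t => pedalPt c e u (v u t)) u t)
    (dSnd (fun u t => pedalPt c e u (v u t)) u t) (ruledVel c e u (v u t)) (e.at u)
  rw [hJ, inner_zero_left] at e5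
  have hw (x : E3) : inner ℝ (pedalPt c e u (v u t)) x = 2 * inner ℝ (ruled c e u (v u t)) x -
      inner ℝ (ruled c e u (v u t)) (ruled c e u (v u t)) / ruledDet c e u (v u t) *
        inner ℝ (cross (ruledVel c e u (v u t)) (e.at u)) x := by
    rw [pedalPt, inner_sub_left, real_inner_smul_left, real_inner_smul_left]
  simp only [hw, inner_add_left, inner_add_right, real_inner_smul_left, real_inner_smul_right,
    inner_zero_right, zero_add] at e1 e2 e3 e4 ⊢
  rw [real_inner_comm (ruledVel c e u (v u t)) (e.at u)] at e3 e4
  generalize inner ℝ (ruled c e u (v u t)) (ruled c e u (v u t)) / ruledDet c e u (v u t) = k at *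
  set a := ruledVel c e u (v u t)
  have hB : inner ℝ (dFst (fun u t => pedalPt c e u (v u t)) u t) (e.at u) =
      2 * inner ℝ a (e.at u) + k * inner ℝ (cross a (e.at u)) (deriv e.at u) +
        dFst v u t * (2 * inner ℝ (e.at u) (e.at u)) := by
    linear_combination e1
  have hD : inner ℝ (dSnd (fun u t => pedalPt c e u (v u t)) u t) (e.at u) =
      dSnd v u t * (2 * inner ℝ (e.at u) (e.at u)) := by
    linear_combination e2
  have hA : inner ℝ (dFst (fun u t => pedalPt c e u (v u t)) u t) a =
      2 * inner ℝ a a + k * (inner ℝ (cross a (e.at u)) (deriv (deriv c.at) u) +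
        v u t * inner ℝ (cross a (e.at u)) (deriv (deriv e.at) u)) +
      dFst v u t * (2 * inner ℝ a (e.at u) + k * inner ℝ (cross a (e.at u)) (deriv e.at u)) := by
    linear_combination e3
  have hC : inner ℝ (dSnd (fun u t => pedalPt c e u (v u t)) u t) a =
      dSnd v u t * (2 * inner ℝ a (e.at u) + k * inner ℝ (cross a (e.at u)) (deriv e.at u)) := by
    linear_combination e4
  rw [hA, hB, hC, hD] at e5
  apply mul_left_cancel₀ (h.reparam u t hp)
  linear_combination -e5

end IsPolarRep

/-! ### A rational parametrization of the directions in a plane -/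

section PolarDirection

/-- The vectors of a plane with normal `A`, obtained from the vector `S` of the plane by
rotations, up to scale; the parameter `t` is the tangent of the half angle, divided by `‖A‖`. -/
noncomputable def polarDir (A S : E3) (t : ℝ) : E3 :=
  (1 - t ^ 2 * inner ℝ A A) • S + (2 * t) • cross A S

variable {A S : E3}

theorem inner_polarDir_normal (hS : inner ℝ S A = 0) (t : ℝ) :
    inner ℝ (polarDir A S t) A = 0 := by
  rw [polarDir, inner_add_left, real_inner_smul_left, real_inner_smul_left, hS,
    real_inner_comm A (cross A S), inner_left_cross]
  ring

theorem inner_polarDir_self (hS : inner ℝ S A = 0) (t : ℝ) :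
    inner ℝ (polarDir A S t) (polarDir A S t) =
      inner ℝ S S * (1 + t ^ 2 * inner ℝ A A) ^ 2 := by
  simp only [polarDir, inner_add_left, inner_add_right, real_inner_smul_left,
    real_inner_smul_right, inner_cross_self, inner_right_cross, real_inner_comm S (cross A S),
    real_inner_comm S A, hS]
  ring

theorem one_add_sq_mul_pos (A : E3) (t : ℝ) : 0 < 1 + t ^ 2 * inner ℝ A A := by
  have : 0 ≤ inner ℝ A A := real_inner_self_nonneg
  positivity

theorem polarDir_ne_zero (hS : inner ℝ S A = 0) (hS0 : S ≠ 0) (t : ℝ) : polarDir A S t ≠ 0 := by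
  intro h
  have h1 := inner_polarDir_self hS t
  rw [h, inner_zero_left, eq_comm, mul_eq_zero] at h1
  rcases h1 with h1 | h1
  · exact hS0 (eq_zero_of_inner_self h1)
  · exact pow_ne_zero 2 (one_add_sq_mul_pos A t).ne' h1

/-- Otherwise A, orthogonal to x and y, would be a nonzero multiple of x × y. -/
theorem cross_eq_zero_of_coplanar {x y : E3} (hA : A ≠ 0) (hx : inner ℝ x A = 0)
    (hy : inner ℝ y A = 0) (h : inner ℝ A (cross x y) = 0) : cross x y = 0 := by
  by_contra h0
  rw [real_inner_comm] at hx hy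
  obtain ⟨l, hl⟩ := eq_smul_cross h0 hx hy
  rw [hl, real_inner_smul_left, mul_eq_zero] at h
  rcases h with h | h
  · exact hA (by rw [hl, h, zero_smul])
  · exact h0 (eq_zero_of_inner_self h)

theorem eq_smul_of_cross_eq_zero {x y : E3} (hx : x ≠ 0) (h : cross x y = 0) :
    y = (inner ℝ y x / inner ℝ x x) • x := by
  have hxx : inner ℝ x x ≠ 0 := fun h' => hx (eq_zero_of_inner_self h')
  have key : inner ℝ x x • y = inner ℝ y x • x + cross (cross x y) x := by
    apply ext3 <;> simp only [inner_eq, cross_zero, cross_one, cross_two, PiLp.add_apply,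
      PiLp.smul_apply, smul_eq_mul] <;> ring
  have h0 : cross (cross x y) x = 0 := by rw [h]; apply ext3 <;> simp
  rw [h0, add_zero] at key
  rw [div_eq_inv_mul, mul_smul, ← key, smul_smul, inv_mul_cancel₀ hxx, one_smul]

theorem cross_smul_smul (x : E3) (a b : ℝ) : cross (a • x) (b • x) = 0 := by
  apply ext3 <;> simp <;> ring

theorem inner_cross_polarDir {x : E3} (hx : inner ℝ x A = 0) (t : ℝ) :
    inner ℝ A (cross (polarDir A S t) x) =
      (1 - t ^ 2 * inner ℝ A A) * inner ℝ A (cross S x) - 2 * t * inner ℝ A A * inner ℝ S x := by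
  have h1 : cross (polarDir A S t) x =
      (1 - t ^ 2 * inner ℝ A A) • cross S x + (2 * t) • cross (cross A S) x := by
    apply ext3 <;> simp only [polarDir, cross_zero, cross_one, cross_two, PiLp.add_apply,
      PiLp.smul_apply, smul_eq_mul] <;> ring
  have h2 : inner ℝ A (cross (cross A S) x) =
      inner ℝ S A * inner ℝ x A - inner ℝ A A * inner ℝ S x := by
    simp only [inner_eq, cross_zero, cross_one, cross_two]
    ring
  rw [h1, inner_add_right, real_inner_smul_right, real_inner_smul_right, h2, hx]
  ring

/-- A direction towards a point of the line is not parallel to the line, because the line does not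
pass through O. So the denominator of the rational parameter is nonzero where it is needed. -/
theorem inner_cross_polarDir_ne_zero {c e : E3} (hA : cross c e ≠ 0)
    (hS : inner ℝ S (cross c e) = 0) (hS0 : S ≠ 0) {v t : ℝ}
    (hv : inner ℝ (cross c e) (cross (polarDir (cross c e) S t) (c + v • e)) = 0) :
    inner ℝ (cross c e) (cross (polarDir (cross c e) S t) e) ≠ 0 := by
  intro h0
  have hσ := polarDir_ne_zero hS hS0 t
  have hσA := inner_polarDir_normal hS t
  have he := eq_smul_of_cross_eq_zero hσ
    (cross_eq_zero_of_coplanar hA hσA (inner_right_cross c e) h0)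
  have hg : inner ℝ (c + v • e) (cross c e) = 0 := by
    rw [inner_add_left, real_inner_smul_left, inner_left_cross, inner_right_cross]
    ring
  have hc := eq_smul_of_cross_eq_zero hσ (cross_eq_zero_of_coplanar hA hσA hg hv)
  apply hA
  have h1 : cross c e = cross (c + v • e) e := by
    apply ext3 <;> simp <;> ring
  exact h1.trans ((congrArg₂ cross hc he).trans (cross_smul_smul _ _ _))

/-- Every point of the line `c + ℝ e` is seen in one of the directions `polarDir`. -/
theorem exists_polarDir {c e : E3} (hA : cross c e ≠ 0) (v : ℝ) :
    ∃ t, inner ℝ (cross c e) (cross (polarDir (cross c e) S t) (c + v • e)) = 0 := by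
  have hg : inner ℝ (c + v • e) (cross c e) = 0 := by
    rw [inner_add_left, real_inner_smul_left, inner_left_cross, inner_right_cross]
    ring
  simp only [inner_cross_polarDir hg]
  have hM : 0 < inner ℝ (cross c e) (cross c e) := real_inner_self_pos.2 hA
  generalize inner ℝ (cross c e) (cross c e) = M at *
  generalize inner ℝ (cross c e) (cross S (c + v • e)) = b
  generalize inner ℝ S (c + v • e) = a
  by_cases hb : b = 0
  · exact ⟨0, by simp [hb]⟩
  · have hsq : 0 ≤ M ^ 2 * a ^ 2 + M * b ^ 2 := by positivity
    -- A root of M b t² + 2 M a t - b = 0, whose discriminant is positive up to the factor 4.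
    refine ⟨(-(M * a) + Real.sqrt (M ^ 2 * a ^ 2 + M * b ^ 2)) / (M * b), ?_⟩
    have h1 := Real.sq_sqrt hsq
    generalize Real.sqrt (M ^ 2 * a ^ 2 + M * b ^ 2) = w at *
    field_simp
    linear_combination (-1) * h1

/-- The numerator of the derivative is a Wronskian, reduced by the Plücker relation `hPl` and S ⊥ c
× e to an explicit product, nonzero for nonzero S. This is what gives v_t ≠ 0. -/
theorem hasDerivAt_polarParam {c e : E3} (hS : inner ℝ S (cross c e) = 0) {t : ℝ}
    (h0 : inner ℝ (cross c e) (cross (polarDir (cross c e) S t) e) ≠ 0) :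
    HasDerivAt (fun t => -inner ℝ (cross c e) (cross (polarDir (cross c e) S t) c) /
        inner ℝ (cross c e) (cross (polarDir (cross c e) S t) e))
      (2 * (1 + t ^ 2 * inner ℝ (cross c e) (cross c e)) *
        (inner ℝ (cross c e) (cross c e) ^ 2 * inner ℝ S S) /
        inner ℝ (cross c e) (cross (polarDir (cross c e) S t) e) ^ 2) t := by
  have hc := inner_cross_polarDir (S := S) (inner_left_cross c e)
  have he := inner_cross_polarDir (S := S) (inner_right_cross c e)
  have hPl : inner ℝ S c * inner ℝ (cross c e) (cross S e) -
      inner ℝ S e * inner ℝ (cross c e) (cross S c) =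
        inner ℝ S S * inner ℝ (cross c e) (cross c e) - inner ℝ S (cross c e) ^ 2 := by
    simp only [inner_eq, cross_zero, cross_one, cross_two]
    ring
  rw [hS] at hPl
  simp only [he] at h0
  simp only [hc, he]
  generalize inner ℝ (cross c e) (cross c e) = M at *
  generalize inner ℝ (cross c e) (cross S e) = α at *
  generalize inner ℝ (cross c e) (cross S c) = α' at *
  have hd (a b : ℝ) : HasDerivAt (fun t : ℝ => (1 - t ^ 2 * M) * a - 2 * t * M * b)
      ((-(2 * t * M)) * a - 2 * M * b) t := by
    have h1 := (((hasDerivAt_id' t).pow 2).mul_const M).const_sub 1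
    have h2 := (((hasDerivAt_id' t).const_mul 2).mul_const M).mul_const b
    refine ((h1.mul_const a).sub h2).congr_deriv ?_
    simp
  refine ((hd α' (inner ℝ S c)).neg.div (hd α (inner ℝ S e)) h0).congr_deriv ?_
  congr 1
  simp only [Pi.neg_apply]
  linear_combination (2 * M * (1 + t ^ 2 * M)) * hPl

end PolarDirection

/-! ### The rational polar representation -/

section RationalPolar

variable {c e : RatCurve}

theorem isRationalMapOn_axisDir {D : Set (ℝ × ℝ)} (hc : ∀ u t, (u, t) ∈ D → c.RegularAt u)
    (he : ∀ u t, (u, t) ∈ D → e.RegularAt u) :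
    IsRationalMapOn (fun u _ => axisDir c e u) D := by
  simp only [axisDir_eq]
  exact (IsRationalMapOn.ratCurve c hc).cross (IsRationalMapOn.ratCurve e he)

theorem isRationalMapOn_polarDir {D : Set (ℝ × ℝ)} {A S : ℝ → ℝ → E3}
    (hA : IsRationalMapOn A D) (hS : IsRationalMapOn S D) :
    IsRationalMapOn (fun u t => polarDir (A u t) (S u t) t) D :=
  (((IsRationalOn.const 1).sub ((IsRationalOn.snd.pow 2).mul (hA.inner hA))).smul hS).add
    (((IsRationalOn.const 2).mul IsRationalOn.snd).smul (hA.cross hS))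

theorem isRationalMapOn_ruled {D : Set (ℝ × ℝ)} (hc : ∀ u t, (u, t) ∈ D → c.RegularAt u)
    (he : ∀ u t, (u, t) ∈ D → e.RegularAt u) {v : ℝ → ℝ → ℝ} (hv : IsRationalOn v D) :
    IsRationalMapOn (fun u t => ruled c e u (v u t)) D :=
  (IsRationalMapOn.ratCurve c hc).add (hv.smul (IsRationalMapOn.ratCurve e he))

theorem isRationalMapOn_ruledVel {D : Set (ℝ × ℝ)} (hD : IsOpen D)
    (hc : ∀ u t, (u, t) ∈ D → c.RegularAt u)
    (he : ∀ u t, (u, t) ∈ D → e.RegularAt u) {v : ℝ → ℝ → ℝ} (hv : IsRationalOn v D) :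
    IsRationalMapOn (fun u t => ruledVel c e u (v u t)) D :=
  (IsRationalMapOn.deriv_ratCurve c hD hc).add (hv.smul (IsRationalMapOn.deriv_ratCurve e hD he))

theorem isRationalOn_ruledDet {D : Set (ℝ × ℝ)} (hD : IsOpen D)
    (hc : ∀ u t, (u, t) ∈ D → c.RegularAt u)
    (he : ∀ u t, (u, t) ∈ D → e.RegularAt u) {v : ℝ → ℝ → ℝ} (hv : IsRationalOn v D) :
    IsRationalOn (fun u t => ruledDet c e u (v u t)) D :=
  (isRationalMapOn_ruled hc he hv).inner
    ((isRationalMapOn_ruledVel hD hc he hv).cross (IsRationalMapOn.ratCurve e he))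

theorem isRationalMapOn_pedalPt {D : Set (ℝ × ℝ)} (hD : IsOpen D) {v : ℝ → ℝ → ℝ}
    (hr : ∀ u t, (u, t) ∈ D → RegularParam c e u (v u t)) (hv : IsRationalOn v D) :
    IsRationalMapOn (fun u t => pedalPt c e u (v u t)) D := by
  have hc : ∀ u t, (u, t) ∈ D → c.RegularAt u := fun u t hp => (hr u t hp).1
  have he : ∀ u t, (u, t) ∈ D → e.RegularAt u := fun u t hp => (hr u t hp).2.1
  have hg := isRationalMapOn_ruled hc he hv
  exact ((IsRationalOn.const 2).smul hg).sub
    (((hg.inner hg).div (isRationalOn_ruledDet hD hc he hv)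
      fun u t hp => (regularParam_iff.1 (hr u t hp)).2.2).smul
        ((isRationalMapOn_ruledVel hD hc he hv).cross (IsRationalMapOn.ratCurve e he)))

theorem eventually_regularParam {u v : ℝ} (h : RegularParam c e u v) :
    ∀ᶠ u' in nhds u, RegularParam c e u' v := by
  obtain ⟨hc, he, hd⟩ := regularParam_iff.1 h
  have h1 : ContinuousAt (fun u' => ruledDet c e u' v) u :=
    (contDiffAt_ruledDet (U := fun u' : ℝ => u') (V := fun _ => v) hc he contDiffAt_id
      contDiffAt_const).continuousAt
  filter_upwards [RatCurve.eventually_regularAt hc, RatCurve.eventually_regularAt he,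
    h1.eventually_ne hd] with u' h1 h2 h3
  exact regularParam_iff.2 ⟨h1, h2, h3⟩

theorem frequently_eval_ne_zero {k : Polynomial ℝ} (hk : k ≠ 0) (u : ℝ) :
    ∃ᶠ u' in nhds u, k.eval u' ≠ 0 := by
  intro h
  exact infinite_of_mem_nhds u h ((Polynomial.finite_setOfPred_isRoot hk).subset fun y hy => by
    simpa using hy)

/-- For generic `u` the rulings are regular and the plane of `O` and the ruling contains a
vector of rational length. -/
theorem exists_generic_plane_vector (hG : ∃ u v, RegularParam c e u v) :
    ∃ (k h : Polynomial ℝ) (S : ℝ → E3), k ≠ 0 ∧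
      IsRationalMapOn (fun u _ => S u) Set.univ ∧ ∀ u, k.eval u ≠ 0 →
        c.RegularAt u ∧ e.RegularAt u ∧ axisDir c e u ≠ 0 ∧ h.eval u ≠ 0 ∧
        inner ℝ (S u) (axisDir c e u) = 0 ∧ inner ℝ (S u) (S u) = h.eval u ^ 2 := by
  obtain ⟨q, C, E, hq0, hq, hC, hE⟩ := exists_common_denominator c e
  let N : Fin 3 → Polynomial ℝ :=
    ![C 1 * E 2 - C 2 * E 1, C 2 * E 0 - C 0 * E 2, C 0 * E 1 - C 1 * E 0]
  have hN (u : ℝ) (hu : q.eval u ≠ 0) (i : Fin 3) :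
      (N i).eval u = q.eval u ^ 2 * axisDir c e u i := by
    rw [axisDir_eq]
    fin_cases i <;> simp [N, ← hC u _ hu, ← hE u _ hu] <;> ring
  obtain ⟨S, h, hh, hSN, hSS⟩ := exists_rational_length N
  -- The roots of this polynomial are the poles, the zeros of the length h, and the parameters where
  -- c and e are dependent.
  refine ⟨q * h * (N 0 ^ 2 + N 1 ^ 2 + N 2 ^ 2), h,
    fun u => WithLp.toLp 2 fun i => (S i).eval u, ?_, fun i => IsRationalOn.polynomial (S i), ?_⟩
  · refine mul_ne_zero (mul_ne_zero hq0 hh) fun h0 => ?_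
    obtain ⟨u, v, huv⟩ := hG
    obtain ⟨hc, he, hd⟩ := regularParam_iff.1 huv
    have hu := (hq u).2 ⟨hc, he⟩
    have h1 := congrArg (Polynomial.eval u) h0
    simp only [Polynomial.eval_add, Polynomial.eval_pow, hN u hu, Polynomial.eval_zero] at h1
    have h2 : q.eval u ^ 4 * inner ℝ (axisDir c e u) (axisDir c e u) = 0 := by
      rw [inner_eq]; linear_combination h1
    have h3 := (mul_eq_zero.1 h2).resolve_left (pow_ne_zero 4 hu)
    exact cross_ne_zero_of_ruledDet_ne hd (axisDir_eq c e u ▸ eq_zero_of_inner_self h3)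
  · intro u hu
    simp only [Polynomial.eval_mul, mul_ne_zero_iff] at hu
    obtain ⟨⟨hqu, hhu⟩, hNu⟩ := hu
    obtain ⟨hc, he⟩ := (hq u).1 hqu
    refine ⟨hc, he, fun h0 => ?_, hhu, ?_, ?_⟩
    · simp [hN u hqu, h0] at hNu
    · have h1 := congrArg (Polynomial.eval u) hSN
      simp only [Polynomial.eval_add, Polynomial.eval_mul, hN u hqu, Polynomial.eval_zero] at h1
      apply mul_left_cancel₀ (pow_ne_zero 2 hqu)
      rw [inner_eq]
      linear_combination h1
    · have h1 := congrArg (Polynomial.eval u) hSS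
      simp only [Polynomial.eval_add, Polynomial.eval_pow] at h1
      rw [inner_eq]
      linear_combination h1

/-- A rational polar parametrization of the rulings, which for generic `u` reaches all points
of the ruling. -/
theorem exists_rational_polar (hG : ∃ u v, RegularParam c e u v) :
    ∃ (k : Polynomial ℝ) (Δ : MvPolynomial (Fin 2) ℝ) (v r : ℝ → ℝ → ℝ) (n : ℝ → ℝ → E3),
      k ≠ 0 ∧ Δ ≠ 0 ∧ IsRationalOn v (nonvanishing Δ) ∧ IsRationalOn r (nonvanishing Δ) ∧
      IsRationalMapOn n (nonvanishing Δ) ∧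
      (∀ u t, (u, t) ∈ nonvanishing Δ → c.RegularAt u ∧ e.RegularAt u ∧ dSnd v u t ≠ 0 ∧
        ‖n u t‖ = 1 ∧ r u t ≠ 0 ∧ ruled c e u (v u t) = r u t • n u t) ∧
      ∀ u, k.eval u ≠ 0 → ∀ v₀, ∃ t, (u, t) ∈ nonvanishing Δ ∧ v u t = v₀ := by
  obtain ⟨k, h, S, hk, hSr, hkS⟩ := exists_generic_plane_vector hG
  let σ : ℝ → ℝ → E3 := fun u t => polarDir (axisDir c e u) (S u) t
  let den : ℝ → ℝ → ℝ := fun u t => inner ℝ (axisDir c e u) (cross (σ u t) (e.at u))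
  let num : ℝ → ℝ → ℝ := fun u t => inner ℝ (axisDir c e u) (cross (σ u t) (c.at u))
  let v : ℝ → ℝ → ℝ := fun u t => -num u t / den u t
  let n : ℝ → ℝ → E3 := fun u t =>
    (h.eval u * (1 + t ^ 2 * inner ℝ (axisDir c e u) (axisDir c e u)))⁻¹ • σ u t
  -- A signed radius: the inner product is rational, whereas the norm need not be, and n need not
  -- point towards g.
  let r : ℝ → ℝ → ℝ := fun u t => inner ℝ (ruled c e u (v u t)) (n u t)
  have hS0 {u : ℝ} (hu : k.eval u ≠ 0) : S u ≠ 0 := by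
    obtain ⟨-, -, -, hh, -, hSS⟩ := hkS u hu
    intro h0
    rw [h0, inner_zero_left] at hSS
    exact pow_ne_zero 2 hh hSS.symm
  have hmul (u v₀ t : ℝ) : inner ℝ (axisDir c e u) (cross (σ u t) (c.at u + v₀ • e.at u)) =
      num u t + v₀ * den u t := by
    have : cross (σ u t) (c.at u + v₀ • e.at u) =
        cross (σ u t) (c.at u) + v₀ • cross (σ u t) (e.at u) := by
      apply ext3 <;> simp <;> ring
    rw [this, inner_add_right, real_inner_smul_right]
  have hsurj (u : ℝ) (hu : k.eval u ≠ 0) (v₀ : ℝ) : ∃ t, den u t ≠ 0 ∧ v u t = v₀ := by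
    obtain ⟨-, -, hA, -, hSA, -⟩ := hkS u hu
    have h1 : axisDir c e u = cross (c.at u) (e.at u) := axisDir_eq c e u
    obtain ⟨t, ht⟩ := exists_polarDir (S := S u) (h1 ▸ hA) v₀
    have hden : den u t ≠ 0 := by
      have := inner_cross_polarDir_ne_zero (h1 ▸ hA) (h1 ▸ hSA) (hS0 hu) ht
      rwa [← h1] at this
    rw [← h1, hmul] at ht
    refine ⟨t, hden, ?_⟩
    simp only [v]
    rw [div_eq_iff hden]
    linarith
  obtain ⟨u₀, hu₀⟩ : ∃ u, k.eval u ≠ 0 := (frequently_eval_ne_zero hk 0).exists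
  -- The one-variable condition k(u) ≠ 0, rewritten as the nonvanishing of a polynomial in (u, t).
  obtain ⟨Δ₁, -, hΔ₁⟩ := IsRationalOn.exists_nonvanishing (Δ := 1) (IsRationalOn.polynomial k)
    ⟨u₀, 0, by simp [nonvanishing], hu₀⟩
  have hΔ₁ : ∀ u t, (u, t) ∈ nonvanishing Δ₁ ↔ k.eval u ≠ 0 := by
    intro u t
    rw [hΔ₁]
    simp [nonvanishing]
  have hc₁ : ∀ u t, (u, t) ∈ nonvanishing Δ₁ → c.RegularAt u := fun u t hp =>
    (hkS u ((hΔ₁ u t).1 hp)).1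
  have he₁ : ∀ u t, (u, t) ∈ nonvanishing Δ₁ → e.RegularAt u := fun u t hp =>
    (hkS u ((hΔ₁ u t).1 hp)).2.1
  have hA := isRationalMapOn_axisDir hc₁ he₁
  have hσ : IsRationalMapOn σ (nonvanishing Δ₁) := 
    isRationalMapOn_polarDir hA (hSr.mono (Set.subset_univ _))
  have hdenr : IsRationalOn den (nonvanishing Δ₁) :=
    hA.inner (hσ.cross (IsRationalMapOn.ratCurve e he₁))
  have hnumr : IsRationalOn num (nonvanishing Δ₁) :=
    hA.inner (hσ.cross (IsRationalMapOn.ratCurve c hc₁))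
  obtain ⟨t₀, ht₀, -⟩ := hsurj u₀ hu₀ 0
  obtain ⟨Δ, hΔ0, hΔ⟩ := hdenr.exists_nonvanishing ⟨u₀, t₀, (hΔ₁ _ _).2 hu₀, ht₀⟩
  have hsub : nonvanishing Δ ⊆ nonvanishing Δ₁ := fun p hp => ((hΔ p.1 p.2).1 hp).1
  have hc : ∀ u t, (u, t) ∈ nonvanishing Δ → c.RegularAt u := fun u t hp => hc₁ u t (hsub hp)
  have he : ∀ u t, (u, t) ∈ nonvanishing Δ → e.RegularAt u := fun u t hp => he₁ u t (hsub hp)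
  have hku {u t : ℝ} (hp : (u, t) ∈ nonvanishing Δ) : k.eval u ≠ 0 := (hΔ₁ u t).1 (hsub hp)
  have hden {u t : ℝ} (hp : (u, t) ∈ nonvanishing Δ) : den u t ≠ 0 := ((hΔ u t).1 hp).2
  have hv : IsRationalOn v (nonvanishing Δ) :=
    (hnumr.mono hsub).neg.div (hdenr.mono hsub) fun u t hp => hden hp
  have hscale {u t : ℝ} (hp : (u, t) ∈ nonvanishing Δ) :
      h.eval u * (1 + t ^ 2 * inner ℝ (axisDir c e u) (axisDir c e u)) ≠ 0 :=
    mul_ne_zero (hkS u (hku hp)).2.2.2.1 (one_add_sq_mul_pos _ t).ne'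
  have hn : IsRationalMapOn n (nonvanishing Δ) :=
    IsRationalOn.smul (((IsRationalOn.polynomial h).mul ((IsRationalOn.const 1).add
      ((IsRationalOn.snd.pow 2).mul ((hA.inner hA).mono hsub)))).inv fun u t hp => hscale hp)
      (hσ.mono hsub)
  refine ⟨k, Δ, v, r, n, hk, hΔ0, hv, (isRationalMapOn_ruled hc he hv).inner hn, hn, ?_, ?_⟩
  · intro u t hp
    obtain ⟨-, -, hAu, hh, hSA, hSS⟩ := hkS u (hku hp)
    have h1 : axisDir c e u = cross (c.at u) (e.at u) := axisDir_eq c e u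
    have hσ0 : σ u t ≠ 0 := polarDir_ne_zero hSA (hS0 (hku hp)) t
    have hnn : inner ℝ (n u t) (n u t) = 1 := by
      simp only [n, σ, real_inner_smul_left, real_inner_smul_right]
      rw [inner_polarDir_self hSA, hSS, ← mul_pow]
      have := (one_add_sq_mul_pos (axisDir c e u) t).ne'
      field_simp
    have hg0 : ruled c e u (v u t) ≠ 0 := by
      intro h0
      apply hAu
      rw [← cross_ruled_dir c e u (v u t), h0]
      apply ext3 <;> simp
    have hzero : cross (σ u t) (ruled c e u (v u t)) = 0 := by
      refine cross_eq_zero_of_coplanar hAu (inner_polarDir_normal hSA t)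
        (inner_axisDir_of_mem (ruled_mem_sectionPlane _ _ _ _)) ?_
      rw [ruled, hmul]
      simp only [v]
      rw [div_mul_cancel₀ _ (hden hp)]
      ring
    have hpolar : ruled c e u (v u t) = r u t • n u t := by
      have h2 := eq_smul_of_cross_eq_zero hσ0 hzero
      have h3 : σ u t =
          (h.eval u * (1 + t ^ 2 * inner ℝ (axisDir c e u) (axisDir c e u))) • n u t := by
        simp only [n]
        rw [smul_smul, mul_inv_cancel₀ (hscale hp), one_smul]
      obtain ⟨l, hl⟩ : ∃ l : ℝ, ruled c e u (v u t) = l • n u t :=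
        ⟨_, h2.trans ((congrArg (_ • ·) h3).trans (smul_smul _ _ _))⟩
      simp only [r]
      rw [hl, real_inner_smul_left, hnn, mul_one]
    refine ⟨hc u t hp, he u t hp, ?_, ?_, ?_, hpolar⟩
    · have hd := hasDerivAt_polarParam (h1 ▸ hSA)
        (show inner ℝ (cross (c.at u) (e.at u)) (cross (polarDir _ (S u) t) (e.at u)) ≠ 0 by
          rw [← h1]; exact hden hp)
      rw [← h1] at hd
      have hd' : dSnd v u t = _ := hd.deriv
      rw [hd', hSS]
      have h2 := (one_add_sq_mul_pos (axisDir c e u) t).ne'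
      have h3 : inner ℝ (axisDir c e u) (axisDir c e u) ≠ 0 := fun h' =>
        hAu (eq_zero_of_inner_self h')
      have h4 : inner ℝ (axisDir c e u)
        (cross (polarDir (axisDir c e u) (S u) t) (e.at u)) ≠ 0 := hden hp
      positivity
    · rw [real_inner_self_eq_norm_sq] at hnn
      exact (pow_eq_one_iff_of_nonneg (norm_nonneg _) two_ne_zero).1 hnn
    · intro h0
      rw [h0, zero_smul] at hpolar
      exact hg0 hpolar
  · intro u hu v₀
    obtain ⟨t, ht, hvt⟩ := hsurj u hu v₀
    exact ⟨t, (hΔ u t).2 ⟨(hΔ₁ u t).2 hu, ht⟩, hvt⟩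

end RationalPolar

/-! ### The rational parametrization of the envelope -/

section RationalEnvelope

variable {c e : RatCurve} {k : Polynomial ℝ} {Δ : MvPolynomial (Fin 2) ℝ} {v r : ℝ → ℝ → ℝ}
  {n : ℝ → ℝ → E3}

/-- For generic u every v is attained on the domain of v(u, t). Continuity of v and density of the
nonvanishing set of Δ' allow the curve where Δ' = 0 to be discarded, and generic u are dense. -/
theorem regularParam_mem_closure {Δ' : MvPolynomial (Fin 2) ℝ} (hΔ' : Δ' ≠ 0) (hk : k ≠ 0)
    (hv : IsRationalOn v (nonvanishing Δ))
    (hsurj : ∀ u, k.eval u ≠ 0 → ∀ v₀, ∃ t, (u, t) ∈ nonvanishing Δ ∧ v u t = v₀) (u₀ v₀ : ℝ) :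
    (u₀, v₀) ∈ closure ((fun p : ℝ × ℝ => (p.1, v p.1 p.2)) '' nonvanishing Δ') := by
  rw [← closure_closure, mem_closure_iff_frequently]
  have hcont : Filter.Tendsto (fun u : ℝ => (u, v₀)) (nhds u₀) (nhds (u₀, v₀)) :=
    ContinuousAt.tendsto (f := fun u : ℝ => (u, v₀)) (by fun_prop)
  refine hcont.frequently ((frequently_eval_ne_zero hk u₀).mono fun u hu => ?_)
  obtain ⟨t, hp, hvt⟩ := hsurj u hu v₀
  have h1 : ContinuousAt (fun p : ℝ × ℝ => (p.1, v p.1 p.2)) (u, t) :=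
    continuousAt_fst.prodMk (hv.contDiffAt (isOpen_nonvanishing Δ) hp).continuousAt
  have h2 := mem_closure_image h1 (dense_nonvanishing hΔ' (u, t))
  simpa only [hvt] using h2

theorem hasDerivAt_component {f : ℝ → E3} {f' : E3} {u : ℝ} (hf : HasDerivAt f f' u) (i : Fin 3) :
    HasDerivAt (fun x => f x i) (f' i) u :=
  (EuclideanSpace.proj (𝕜 := ℝ) i).hasFDerivAt.comp_hasDerivAt u hf

theorem hasDerivAt_triple {f g h : ℝ → E3} {f' g' h' : E3} {u : ℝ} (hf : HasDerivAt f f' u)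
    (hg : HasDerivAt g g' u) (hh : HasDerivAt h h' u) :
    HasDerivAt (fun x => inner ℝ (f x) (cross (g x) (h x)))
      (inner ℝ f' (cross (g u) (h u)) + inner ℝ (f u) (cross g' (h u)) +
        inner ℝ (f u) (cross (g u) h')) u := by
  have F := hasDerivAt_component hf
  have G := hasDerivAt_component hg
  have H := hasDerivAt_component hh
  simp only [inner_eq, cross_zero, cross_one, cross_two]
  refine ((((F 0).mul (((G 1).mul (H 2)).sub ((G 2).mul (H 1)))).add
    ((F 1).mul (((G 2).mul (H 0)).sub ((G 0).mul (H 2))))).add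
    ((F 2).mul (((G 0).mul (H 1)).sub ((G 1).mul (H 0))))).congr_deriv ?_
  simp only [Pi.sub_apply, Pi.mul_apply]
  ring

/-- The envelope is not a curve: it is immersed somewhere. -/
theorem exists_immersed (hG : ∃ u v, RegularParam c e u v) (hk : k ≠ 0)
    (hsurj : ∀ u, k.eval u ≠ 0 → ∀ v₀, RegularParam c e u v₀ →
      ∃ t, (u, t) ∈ nonvanishing Δ ∧ v u t = v₀)
    (hpol : IsPolarRep c e (nonvanishing Δ) v r n) :
    ∃ u t, (u, t) ∈ nonvanishing Δ ∧ cross (dFst (fun u t => pedalPt c e u (v u t)) u t)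
      (dSnd (fun u t => pedalPt c e u (v u t)) u t) ≠ 0 := by
  by_contra! hcon
  -- A single regular point of the ruling suffices: surjectivity of t ↦ v(u, t) supplies the
  -- degeneracy at all regular points of the ruling.
  have hrel (u v₀ : ℝ) (hku : k.eval u ≠ 0) (hr : RegularParam c e u v₀) :=
    ruling_relation (c := c.at u) (c₁ := deriv c.at u) (c₂ := deriv (deriv c.at) u)
      (e := e.at u) (e₁ := deriv e.at u) (e₂ := deriv (deriv e.at) u)
      (cross_ne_zero_of_ruledDet_ne (regularParam_iff.1 hr).2.2)
      (by
        by_contra! h0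
        apply (regularParam_iff.1 hr).2.2
        have h1 : ruledDet c e u v₀ = inner ℝ (c.at u) (cross (deriv c.at u) (e.at u)) +
            v₀ * inner ℝ (c.at u) (cross (deriv e.at u) (e.at u)) := by
          simp only [ruledDet, ruled, ruledVel, inner_eq, cross_zero, cross_one, cross_two,
            PiLp.add_apply, PiLp.smul_apply, smul_eq_mul]
          ring
        rw [h1, h0.1, h0.2]
        ring)
      (fun w hw => by
        obtain ⟨t, hp, rfl⟩ := hsurj u hku w (regularParam_iff.2 ⟨hr.1, hr.2.1, hw⟩)
        exact hpol.degenerate_of_cross_eq_zero hp (hcon u t hp))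
  obtain ⟨u₀, v₀, hr₀⟩ := hG
  obtain ⟨u, hu, hr⟩ :=
    ((frequently_eval_ne_zero hk u₀).and_eventually (eventually_regularParam hr₀)).exists
  obtain ⟨hb, hδ, hrel'⟩ := hrel u v₀ hu hr
  -- The relation c·(e' × e) = 0 holds at all neighbouring parameters, so it may be differentiated.
  have hev : ∀ᶠ u' in nhds u,
      inner ℝ (c.at u') (cross (deriv e.at u') (e.at u')) = 0 := by
    filter_upwards [eventually_regularParam hr, k.continuous.continuousAt.eventually_ne hu]
      with u' h1 h2
    exact (hrel u' v₀ h2 h1).1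
  have hE := RatCurve.hasDerivAt hr.2.1
  have hE' : HasDerivAt (deriv e.at) (deriv (deriv e.at) u) u :=
    ((RatCurve.contDiffAt_deriv hr.2.1).differentiableAt (by simp)).hasDerivAt
  have h1 := hasDerivAt_unique_of_eventuallyEq
    (hasDerivAt_triple (RatCurve.hasDerivAt hr.1) hE' hE) (hasDerivAt_const u (0 : ℝ)) hev
  have h2 : inner ℝ (c.at u) (cross (deriv e.at u) (deriv e.at u)) = 0 := by
    simp only [inner_eq, cross_zero, cross_one, cross_two]
    ring
  rw [h2, add_zero] at h1
  exact deriv_relation_false hδ hb h1 hrel'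

/-- The domain of the rational polar representation is shrunk twice by a polynomial condition that
holds somewhere: first to regular parameters, then to those where |f_u × f_t|² ≠ 0. Density in (u,
v) passes to both surfaces by continuity. -/
theorem exists_rational_envelope (hG : ∃ u v, RegularParam c e u v) :
    ∃ (Δ : MvPolynomial (Fin 2) ℝ) (v r : ℝ → ℝ → ℝ) (n f : ℝ → ℝ → E3),
      Δ ≠ 0 ∧
      IsRationalOn v (nonvanishing Δ) ∧ IsRationalOn r (nonvanishing Δ) ∧
      IsRationalMapOn n (nonvanishing Δ) ∧ IsRationalMapOn f (nonvanishing Δ) ∧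
      IsPolarRep c e (nonvanishing Δ) v r n ∧
      {x | ∃ u k, RegularParam c e u k ∧ x = ruled c e u k} ⊆
        closure ((fun p : ℝ × ℝ => r p.1 p.2 • n p.1 p.2) '' nonvanishing Δ) ∧
      (∀ u t, (u, t) ∈ nonvanishing Δ →
        IsInvPedalPoint (fun u' t' => ruled c e u' (v u' t')) u t (f u t)) ∧
      (∀ u t, (u, t) ∈ nonvanishing Δ → LinearIndependent ℝ ![dFst f u t, dSnd f u t]) ∧
      IsUnitNormalOn f n (nonvanishing Δ) ∧
      (fun p : ℝ × ℝ => f p.1 p.2) '' nonvanishing Δ ⊆ invPedalSurface c e ∧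
      invPedalSurface c e ⊆ closure ((fun p : ℝ × ℝ => f p.1 p.2) '' nonvanishing Δ) := by
  obtain ⟨k, Δ₂, v, r, n, hk, -, hv, hr, hn, hprop, hsurj⟩ := exists_rational_polar hG
  have hdet := isRationalOn_ruledDet (isOpen_nonvanishing Δ₂) (fun u t hp => (hprop u t hp).1)
    (fun u t hp => (hprop u t hp).2.1) hv
  obtain ⟨Δ₃, -, hΔ₃⟩ := hdet.exists_nonvanishing (by
    obtain ⟨u₀, v₀, hr₀⟩ := hG
    obtain ⟨u, hu, hru⟩ :=
      ((frequently_eval_ne_zero hk u₀).and_eventually (eventually_regularParam hr₀)).exists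
    obtain ⟨t, hp, ht⟩ := hsurj u hu v₀
    exact ⟨u, t, hp, by rw [ht]; exact (regularParam_iff.1 hru).2.2⟩)
  have hsub₃ : nonvanishing Δ₃ ⊆ nonvanishing Δ₂ := fun p hp => ((hΔ₃ p.1 p.2).1 hp).1
  have hpol : IsPolarRep c e (nonvanishing Δ₃) v r n :=
    { isOpen := isOpen_nonvanishing Δ₃
      smooth_v := (hv.mono hsub₃).contDiffOn (isOpen_nonvanishing Δ₃)
      smooth_r := (hr.mono hsub₃).contDiffOn (isOpen_nonvanishing Δ₃)
      smooth_s := (hn.mono hsub₃).contDiffOn (isOpen_nonvanishing Δ₃)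
      regular := fun u t hp => regularParam_iff.2 ⟨(hprop u t (hsub₃ hp)).1,
        (hprop u t (hsub₃ hp)).2.1, ((hΔ₃ u t).1 hp).2⟩
      reparam := fun u t hp => (hprop u t (hsub₃ hp)).2.2.1
      unit := fun u t hp => (hprop u t (hsub₃ hp)).2.2.2.1
      radius_ne := fun u t hp => (hprop u t (hsub₃ hp)).2.2.2.2.1
      polar := fun u t hp => (hprop u t (hsub₃ hp)).2.2.2.2.2 }
  have hf := isRationalMapOn_pedalPt hpol.isOpen hpol.regular (hv.mono hsub₃)
  have hfc := (hf.dFst hpol.isOpen).cross (hf.dSnd hpol.isOpen)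
  obtain ⟨Δ, hΔ0, hΔ⟩ := (hfc.inner hfc).exists_nonvanishing (by
    obtain ⟨u, t, hp, hne⟩ := exists_immersed hG hk (fun u hu v₀ hru => by
      obtain ⟨t, hp, ht⟩ := hsurj u hu v₀
      exact ⟨t, (hΔ₃ u t).2 ⟨hp, by rw [ht]; exact (regularParam_iff.1 hru).2.2⟩, ht⟩) hpol
    exact ⟨u, t, hp, fun h => hne (eq_zero_of_inner_self h)⟩)
  have hsub : nonvanishing Δ ⊆ nonvanishing Δ₃ := fun p hp => ((hΔ p.1 p.2).1 hp).1
  have hpol' := hpol.mono (isOpen_nonvanishing Δ) hsub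
  have hdense := regularParam_mem_closure hΔ0 hk hv hsurj
  refine ⟨Δ, v, r, n, fun u t => pedalPt c e u (v u t), hΔ0, (hv.mono (hsub.trans hsub₃)),
    (hr.mono (hsub.trans hsub₃)), hn.mono (hsub.trans hsub₃), hf.mono hsub, hpol', ?_,
    fun u t hp => (hpol'.isInvPedalPoint_iff_eq_pedalPt hp _).2 rfl, ?_, ?_, ?_, ?_⟩
  · rintro _ ⟨u, w, hw, rfl⟩
    have h1 : ContinuousAt (fun p : ℝ × ℝ => ruled c e p.1 p.2) (u, w) :=
      (contDiffAt_ruled (U := Prod.fst) (V := Prod.snd) (p := (u, w)) hw.1 hw.2.1 contDiffAt_fst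
        contDiffAt_snd).continuousAt
    have h2 := mem_closure_image h1 (hdense u w)
    rw [Set.image_image] at h2
    rwa [Set.image_congr (fun p hp => (hpol'.polar p.1 p.2 hp).symm)]
  · intro u t hp
    rw [linearIndependent_pair_iff]
    intro h0
    apply ((hΔ u t).1 hp).2
    rw [h0, inner_zero_left]
  · exact hpol'.isUnitNormalOn_pedalPt
  · rintro _ ⟨p, hp, rfl⟩
    exact ⟨p.1, v p.1 p.2, hpol'.regular p.1 p.2 hp,
      (isInvPedalPoint_ruled_iff (hpol'.regular p.1 p.2 hp) _).2 rfl⟩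
  · rintro x ⟨u, w, hw, hx⟩
    rw [isInvPedalPoint_ruled_iff hw] at hx
    subst hx
    have h1 : ContinuousAt (fun p : ℝ × ℝ => pedalPt c e p.1 p.2) (u, w) :=
      (contDiffAt_pedalPt (U := Prod.fst) (V := Prod.snd) (p := (u, w)) hw contDiffAt_fst
        contDiffAt_snd).continuousAt
    have h2 := mem_closure_image h1 (hdense u w)
    rwa [Set.image_image] at h2

end RationalEnvelope

end PedalGeom

/-! ### Inverse pedal surfaces of rational ruled surfaces and their offsets -/

theorem mainTheorem5 (c e : RatCurve) (hG : ∃ u v, RegularParam c e u v) :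
    -- a rational polar representation of `G` and a rational parametrization of `F`
    -- with rational unit normal
    (∃ (Δ : MvPolynomial (Fin 2) ℝ) (v r : ℝ → ℝ → ℝ) (n f : ℝ → ℝ → E3),
      Δ ≠ 0 ∧
      IsRationalOn v (nonvanishing Δ) ∧ IsRationalOn r (nonvanishing Δ) ∧
      IsRationalMapOn n (nonvanishing Δ) ∧ IsRationalMapOn f (nonvanishing Δ) ∧
      IsPolarRep c e (nonvanishing Δ) v r n ∧
      {x | ∃ u k, RegularParam c e u k ∧ x = ruled c e u k} ⊆
        closure ((fun p : ℝ × ℝ => r p.1 p.2 • n p.1 p.2) '' nonvanishing Δ) ∧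
      (∀ u t, (u, t) ∈ nonvanishing Δ →
        IsInvPedalPoint (fun u' t' => ruled c e u' (v u' t')) u t (f u t)) ∧
      (∀ u t, (u, t) ∈ nonvanishing Δ → LinearIndependent ℝ ![dFst f u t, dSnd f u t]) ∧
      IsUnitNormalOn f n (nonvanishing Δ) ∧
      (fun p : ℝ × ℝ => f p.1 p.2) '' nonvanishing Δ ⊆ invPedalSurface c e ∧
      invPedalSurface c e ⊆ closure ((fun p : ℝ × ℝ => f p.1 p.2) '' nonvanishing Δ)) ∧
    -- the rational one-parameter family of parabolic cylinders
    (∀ u, c.RegularAt u → e.RegularAt u → LinearIndependent ℝ ![c.at u, e.at u] →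
      Set.range (parabolaPoint c e u) = parabola c e u ∧
      {x | ∃ k l : ℝ, x = parabolaPoint c e u k + l • axisDir c e u} = parabolicCylinder c e u) ∧
    (∃ H : MvPolynomial (Fin 4) ℝ,
      ∀ u, c.RegularAt u → e.RegularAt u → LinearIndependent ℝ ![c.at u, e.at u] →
        parabolicCylinder c e u = {x | MvPolynomial.eval ![u, x 0, x 1, x 2] H = 0}) ∧
    -- conchoids, offsets and envelopes, for every polar representation `r s` of `G`
    (∀ (U : Set (ℝ × ℝ)) (v r : ℝ → ℝ → ℝ) (s : ℝ → ℝ → E3), IsPolarRep c e U v r s →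
      ∃ f : ℝ → ℝ → E3,
        ContDiffOn ℝ ∞ (fun p : ℝ × ℝ => f p.1 p.2) U ∧
        -- `f` parametrizes the inverse pedal surface of `G`, with unit normal `s`
        (∀ u t, (u, t) ∈ U → ∀ x,
          IsInvPedalPoint (fun u' t' => ruled c e u' (v u' t')) u t x ↔ x = f u t) ∧
        (∀ u t, (u, t) ∈ U → f u t ∈ invPedalSurface c e) ∧
        IsUnitNormalOn f s U ∧
        ∀ d : ℝ,
          -- the inverse pedal surface of the conchoid `G_d` is the offset `F_d`, and
          -- `α*` maps points of `G_d` to tangent planes of `F_d`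
          (∀ u t, (u, t) ∈ U → r u t + d ≠ 0 → ∀ x,
            IsInvPedalPoint (conchoid r s d) u t x ↔ x = offset f s d u t) ∧
          (∀ u t, (u, t) ∈ U → r u t + d ≠ 0 →
            offset f s d u t ∈ alphaStar (conchoid r s d u t)) ∧
          IsUnitNormalOn (offset f s d) s U ∧
          -- `s` is normal to the cylinders, and the orthogonal cross sections of the
          -- offset cylinders are the offsets of the parabolas
          (∀ u t, (u, t) ∈ U →
            s u t ∈ sectionPlane c e u ∧
            dSnd (fun u' t' => parabolaPoint c e u' (v u' t')) u t ≠ 0 ∧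
            inner ℝ (s u t) (dSnd (fun u' t' => parabolaPoint c e u' (v u' t')) u t) = 0 ∧
            inner ℝ (s u t) (axisDir c e u) = 0) ∧
          (∀ u,
            {x | x ∈ sectionPlane c e u ∧
              ∃ t l, (u, t) ∈ U ∧ x = offsetCylinder c e v s d u t l} =
            {x | ∃ t, (u, t) ∈ U ∧ x = parabolaPoint c e u (v u t) + d • s u t}) ∧
          -- `F_d` is the envelope of the offset cylinders; `d = 0` is the case of `F`
          IsEnvelopeOn (offsetCylinder c e v s d) (offset f s d) U) := by
  refine ⟨exists_rational_envelope hG, ?_, ?_, ?_⟩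
  · intro u _ _ hli
    rw [linearIndependent_pair_iff, ← axisDir_eq] at hli
    exact ⟨range_parabolaPoint hli, setOf_parabolicCylinder hli⟩
  · obtain ⟨H, hH⟩ := exists_cylinder_polynomial c e
    refine ⟨H, fun u hc he hli => hH u hc he ?_⟩
    rwa [linearIndependent_pair_iff, ← axisDir_eq] at hli
  · intro U v r s h
    refine ⟨fun u t => pedalPt c e u (v u t),
      fun p hp => (h.contDiffAt_pedalPt hp).contDiffWithinAt,
      fun u t hp => h.isInvPedalPoint_iff_eq_pedalPt hp,
      fun u t hp => ⟨u, v u t, h.regular u t hp,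
        (isInvPedalPoint_ruled_iff (h.regular u t hp) _).2 rfl⟩, ?_, fun d => ?_⟩
    · exact h.isUnitNormalOn_pedalPt
    · refine ⟨fun u t hp hd x => ?_, fun u t hp _ => ?_, h.isUnitNormalOn_offset d,
        fun u t hp => ⟨h.s_mem hp, h.dSnd_parabolaPoint_ne hp, h.inner_s_dSnd_parabolaPoint hp,
          h.inner_s_axisDir hp⟩, h.crossSection_eq d, h.isEnvelopeOn d⟩
      · rw [h.isInvPedalPoint_conchoid_iff hp hd, h.eq_offset_iff hp]
      · change inner ℝ _ (conchoid r s d u t) = inner ℝ (conchoid r s d u t) (conchoid r s d u t)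
        simp only [conchoid, real_inner_smul_left, real_inner_smul_right, h.inner_offset hp,
          h.inner_s_s hp, mul_one]
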